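/- Let $M$ be a smooth finite-dimensional manifold, $A\subset TM\setminus 0$ a conic open set ($v\in A,\ \lambda>0\Rightarrow \lambda v\in A$) and $L:A\to\mathbb R$ a pseudo-Finsler metric, i.e. a smooth function with $L(\lambda v)=\lambda^2L(v)$ for $\lambda>0$ whose fundamental tensor $g_v(u,w)=\frac12\frac{\partial^2}{\partial s\,\partial t}L(v+su+tw)\big|_{s=t=0}$ is non-degenerate for every $v\in A$. Let $C_v(u,w,z)=\frac12\frac{\partial}{\partial t}g_{v+tz}(u,w)\big|_{t=0}$ be the Cartan tensor, and let $\widetilde\nabla$ be the Levi-Civita–Chern connection of $(M,L)$, the unique torsion-free anisotropic connection such that $$X(g_V(Y,Z))=g_V(\widetilde\nabla^V_XY,Z)+g_V(Y,\widetilde\nabla^V_XZ)+2C_V(\widetilde\nabla^V_XV,Y,Z)$$ for all local vector fields $X,Y,Z,V$ with $V$ taking values in $A$. Let $\widetilde R_v(X,Y)Z=\widetilde\nabla^v_X(\widetilde\nabla_YZ)-\widetilde\nabla^v_Y(\widetilde\nabla_XZ)-\widetilde\nabla^v_{[X,Y]}Z$ be its curvature tensor, where the derivative of an anisotropic vector field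 $T$ is $\widetilde\nabla^v_XT=\widetilde\nabla^V_X(T_V)-\frac{\partial}{\partial t}T_{v+t\widetilde\nabla^v_XV}\big|_{t=0}$ for any local extension $V$ of $v$. The flag curvature of $(M,L)$ with flagpole $v\in A$ and flag $u$ such that $L(v)g_v(u,u)-g_v(v,u)^2\neq0$ is $$\widetilde K_v(u)=\frac{g_v(\widetilde R_v(v,u)u,v)}{L(v)g_v(u,u)-g_v(v,u)^2}.$$ A geodesic of $(M,L)$ is a curve $\gamma$ with $\dot\gamma\in A$ and $\widetilde\nabla^{\dot\gamma}_{\dot\gamma}\dot\gamma=0$. Let $S$ be an (immersed, in particular possibly embedded) submanifold of $M$ which is non-degenerate: the restriction of $g_v$ to the tangent space of $S$ is non-degenerate for every $v\in TS\cap A$. Then $L|_S:=L|_{TS\cap A}$ is a pseudo-Finsler metric on $S$; let $K$ be its flag curvature. Assume that $S$ is totally geodesic, i.e. that every geodesic of $(S,L|_S)$ is a geodesic of $(M,L)$. Then for every $v\in TS\cap A$ and every $u$ in the tangent space of $S$ at the base point of $v$ such that $L(v)g_v(u,u)-g_v(v,u)^2\neq 0$, $$K_v(u)=\widetilde K_v(u).$$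 -/

import Mathlib

open scoped Manifold ContDiff

noncomputable section

namespace PseudoFinsler

/-! ### Fundamental tensor and Cartan tensor of a function on a vector space -/

section Vertical

variable {V : Type*} [AddCommGroup V] [Module ℝ V]

/-- `g_v(u, w) = (1/2) ∂²/∂s∂t ℓ(v + s u + t w)` at `s = t = 0`. -/
def fundForm (l : V → ℝ) (v u w : V) : ℝ :=
  (1 / 2) * deriv (fun s : ℝ => deriv (fun t : ℝ => l (v + s • u + t • w)) 0) 0

/-- `C_v(u, w, z) = (1/2) ∂/∂t g_{v + t z}(u, w)` at `t = 0`. -/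
def cartanForm (l : V → ℝ) (v u w z : V) : ℝ :=
  (1 / 2) * deriv (fun t : ℝ => fundForm l (v + t • z) u w) 0

theorem fundForm_comp {W : Type*} [AddCommGroup W] [Module ℝ W] (l : W → ℝ) (B : V →ₗ[ℝ] W)
    (v u w : V) : fundForm (fun x => l (B x)) v u w = fundForm l (B v) (B u) (B w) := by
  simp [fundForm, map_add, map_smul]

end Vertical

/-! ### The Levi-Civita-Chern connection in coordinates

Throughout, `l : E × E → ℝ` is the coordinate expression `(x, y) ↦ L(y at x)` of a pseudo-Finsler
metric. An anisotropic connection has coordinate expression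
`∇^v_X Y = D_X Y + Γ_v(X, Y)`, with `Γ_v` bilinear, depending on `v = (x, y)`. -/

section Coordinates

variable {E : Type*} [NormedAddCommGroup E] [NormedSpace ℝ E]

/-- The fundamental tensor at `z = (x, y)` in coordinates. -/
def coordFund (l : E × E → ℝ) (z : E × E) (u w : E) : ℝ :=
  fundForm (fun y => l (z.1, y)) z.2 u w

/-- The Cartan tensor at `z = (x, y)` in coordinates. -/
def coordCartan (l : E × E → ℝ) (z : E × E) (u w a : E) : ℝ :=
  cartanForm (fun y => l (z.1, y)) z.2 u w a

/-- `Γ` is the value at `z = (x, y)` of the Christoffel symbols of a torsion-free and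
`g`-compatible anisotropic connection:
`X (g_V(Y, Z)) = g_V(∇^V_X Y, Z) + g_V(Y, ∇^V_X Z) + 2 C_V(∇^V_X V, Y, Z)`,
written for fields `X, Y, Z, V` with constant coordinates, `V = y`. (The condition for arbitrary
fields follows from this one by the Leibniz and chain rules.) -/
structure IsChernSymbol (l : E × E → ℝ) (z : E × E) (Γ : E →L[ℝ] E →L[ℝ] E) : Prop where
  torsion_free : ∀ X Y : E, Γ X Y = Γ Y X
  compatible : ∀ X Y Z : E,
    deriv (fun t : ℝ => coordFund l (z.1 + t • X, z.2) Y Z) 0 =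
      coordFund l z (Γ X Y) Z + coordFund l z Y (Γ X Z) + 2 * coordCartan l z (Γ X z.2) Y Z

open Classical in
/-- The Christoffel symbols of the Levi-Civita-Chern connection at `z = (x, y)`: the unique
solution of `IsChernSymbol` (it exists and is unique wherever `l` is the coordinate expression of
a pseudo-Finsler metric; the value `0` is used elsewhere). -/
def chernSymbol (l : E × E → ℝ) (z : E × E) : E →L[ℝ] E →L[ℝ] E :=
  if h : ∃! Γ : E →L[ℝ] E →L[ℝ] E, IsChernSymbol l z Γ then h.exists.choose else 0

/-- The derivative `∇^v_X T` at `v = z = (x, y)` of an anisotropic vector field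
`T`, i.e. `∇^V_X (T_V) - (∂^ν T)_v(∇^v_X V)` for any extension `V` of `v`. In coordinates, with
`V` constant: `D_x T (X) - D_y T (Γ_v(X, y)) + Γ_v(X, T)`. -/
def coordAnisoDeriv (l : E × E → ℝ) (T : E × E → E) (z : E × E) (X : E) : E :=
  fderiv ℝ T z (X, -chernSymbol l z X z.2) + chernSymbol l z X (T z)

/-- The curvature tensor `R_v(X, Y) Z = ∇^v_X (∇_Y Z) - ∇^v_Y (∇_X Z) - ∇^v_{[X, Y]} Z` at
`v = z = (x, y)`, with `X, Y, Z` extended to fields with constant coordinates, so that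
`[X, Y] = 0` and `∇_Y Z` is the anisotropic vector field `Γ(Y, Z)`. -/
def coordCurvature (l : E × E → ℝ) (z : E × E) (X Y Z : E) : E :=
  coordAnisoDeriv l (fun z' => chernSymbol l z' Y Z) z X -
    coordAnisoDeriv l (fun z' => chernSymbol l z' X Z) z Y

end Coordinates

end PseudoFinsler

/-! ### Pseudo-Finsler metrics on manifolds -/

/-- A pseudo-Finsler metric on the manifold `M`: a conic open subset `dom` (written `A`) of
`TM \ 0` and a smooth, positively 2-homogeneous function `L` on it whose fundamental tensor is
non-degenerate. The values of `L` outside `dom` are irrelevant. -/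
structure PseudoFinslerMetric (E : Type*) [NormedAddCommGroup E] [NormedSpace ℝ E]
    (M : Type*) [TopologicalSpace M] [ChartedSpace E M] [IsManifold 𝓘(ℝ, E) ∞ M] where
  dom : Set (TangentBundle 𝓘(ℝ, E) M)
  L : TangentBundle 𝓘(ℝ, E) M → ℝ
  isOpen_dom : IsOpen dom
  ne_zero : ∀ v ∈ dom, v.2 ≠ 0
  smul_mem : ∀ v ∈ dom, ∀ c : ℝ, 0 < c → (⟨v.1, c • v.2⟩ : TangentBundle 𝓘(ℝ, E) M) ∈ dom
  smooth : ContMDiffOn 𝓘(ℝ, E).tangent 𝓘(ℝ, ℝ) ∞ L dom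
  homogeneous : ∀ v ∈ dom, ∀ c : ℝ, 0 < c →
    L (⟨v.1, c • v.2⟩ : TangentBundle 𝓘(ℝ, E) M) = c ^ 2 * L v
  nondegenerate : ∀ v ∈ dom, ∀ u : TangentSpace 𝓘(ℝ, E) v.1,
    (∀ w : TangentSpace 𝓘(ℝ, E) v.1,
      PseudoFinsler.fundForm (fun y : TangentSpace 𝓘(ℝ, E) v.1 => L ⟨v.1, y⟩) v.2 u w = 0) →
    u = 0

namespace PseudoFinslerMetric

section Basic

variable {E : Type*} [NormedAddCommGroup E] [NormedSpace ℝ E]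
  {M : Type*} [TopologicalSpace M] [ChartedSpace E M] [IsManifold 𝓘(ℝ, E) ∞ M]
  (F : PseudoFinslerMetric E M)

/-- The fundamental tensor `g_v(u, w)`. -/
def fund (v : TangentBundle 𝓘(ℝ, E) M) (u w : TangentSpace 𝓘(ℝ, E) v.1) : ℝ :=
  PseudoFinsler.fundForm (fun y : TangentSpace 𝓘(ℝ, E) v.1 => F.L ⟨v.1, y⟩) v.2 u w

/-- The coordinate expression of `L` in the preferred chart `φ` at `p`:
`(x, y) ↦ L (d(φ⁻¹)_x y)`. -/
def coord (p : M) : E × E → ℝ := fun z =>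
  F.L (tangentMap 𝓘(ℝ, E) 𝓘(ℝ, E) (chartAt E p).symm ⟨z.1, z.2⟩)

/-- The curvature tensor `R_v(X, Y) Z` of the Levi-Civita-Chern connection, computed in the
preferred chart `φ` at the base point `p` of `v`. The tangent space at `p` is identified with `E`
through `dφ_p`, by the definition of `TangentSpace`. -/
def curvature (v : TangentBundle 𝓘(ℝ, E) M) (X Y Z : TangentSpace 𝓘(ℝ, E) v.1) :
    TangentSpace 𝓘(ℝ, E) v.1 :=
  PseudoFinsler.coordCurvature (E := E) (F.coord v.1) (chartAt E v.1 v.1, v.2) X Y Z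

/-- `L(v) g_v(u, u) - g_v(v, u)²`. -/
def flagDenom (v : TangentBundle 𝓘(ℝ, E) M) (u : TangentSpace 𝓘(ℝ, E) v.1) : ℝ :=
  F.L v * F.fund v u u - F.fund v v.2 u ^ 2

/-- The flag curvature `K_v(u) = g_v(R_v(v, u) u, v) / (L(v) g_v(u, u) - g_v(v, u)²)` with
flagpole `v` and flag `u`; meaningful when `v ∈ A` and `flagDenom v u ≠ 0`. -/
def flagCurvature (v : TangentBundle 𝓘(ℝ, E) M) (u : TangentSpace 𝓘(ℝ, E) v.1) : ℝ :=
  F.fund v (F.curvature v v.2 u u) v.2 / F.flagDenom v u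

/-- `γ` is a geodesic on `J`: a `C²` curve with velocity in `A` such that
`∇^{γ'}_{γ'} γ' = 0`; at time `t` the equation is written in the preferred chart at `γ t`. -/
structure IsGeodesicOn (γ : ℝ → M) (J : Set ℝ) : Prop where
  contMDiffOn : ContMDiffOn 𝓘(ℝ, ℝ) 𝓘(ℝ, E) 2 γ J
  velocity_mem : ∀ t ∈ J,
    (⟨γ t, mfderiv 𝓘(ℝ, ℝ) 𝓘(ℝ, E) γ t (1 : ℝ)⟩ : TangentBundle 𝓘(ℝ, E) M) ∈ F.dom
  geodesic_eq : ∀ t ∈ J,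
    deriv (deriv (fun s => chartAt E (γ t) (γ s))) t +
      PseudoFinsler.chernSymbol (F.coord (γ t))
        (chartAt E (γ t) (γ t), deriv (fun s => chartAt E (γ t) (γ s)) t)
        (deriv (fun s => chartAt E (γ t) (γ s)) t)
        (deriv (fun s => chartAt E (γ t) (γ s)) t) = 0

end Basic

section Submanifold

variable {E : Type*} [NormedAddCommGroup E] [NormedSpace ℝ E]
  {M : Type*} [TopologicalSpace M] [ChartedSpace E M] [IsManifold 𝓘(ℝ, E) ∞ M]
  {E' : Type*} [NormedAddCommGroup E'] [NormedSpace ℝ E']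
  {S : Type*} [TopologicalSpace S] [ChartedSpace E' S] [IsManifold 𝓘(ℝ, E') ∞ S]

/-- `i : S → M` is a non-degenerate (immersed) submanifold of `(M, L)`: a smooth immersion such
that for every `v ∈ TS ∩ A` the restriction of `g_v` to the tangent space of `S` is
non-degenerate. -/
structure IsNondegenerateSubmanifold (F : PseudoFinslerMetric E M) (i : S → M) : Prop where
  smooth : ContMDiff 𝓘(ℝ, E') 𝓘(ℝ, E) ∞ i
  immersion : ∀ p : S, Function.Injective (mfderiv 𝓘(ℝ, E') 𝓘(ℝ, E) i p)
  nondegenerate : ∀ v : TangentBundle 𝓘(ℝ, E') S,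
    tangentMap 𝓘(ℝ, E') 𝓘(ℝ, E) i v ∈ F.dom →
    ∀ u : TangentSpace 𝓘(ℝ, E') v.1,
      (∀ w : TangentSpace 𝓘(ℝ, E') v.1,
        F.fund (tangentMap 𝓘(ℝ, E') 𝓘(ℝ, E) i v)
          (mfderiv 𝓘(ℝ, E') 𝓘(ℝ, E) i v.1 u) (mfderiv 𝓘(ℝ, E') 𝓘(ℝ, E) i v.1 w) = 0) →
      mfderiv 𝓘(ℝ, E') 𝓘(ℝ, E) i v.1 u = 0

/-- The restriction `L|_S`, defined on `TS ∩ A`. -/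
def restrict (F : PseudoFinslerMetric E M) (i : S → M) (hi : F.IsNondegenerateSubmanifold (E' := E') i) :
    PseudoFinslerMetric E' S where
  dom := tangentMap 𝓘(ℝ, E') 𝓘(ℝ, E) i ⁻¹' F.dom
  L := fun v => F.L (tangentMap 𝓘(ℝ, E') 𝓘(ℝ, E) i v)
  isOpen_dom := F.isOpen_dom.preimage
    ((hi.smooth.contMDiff_tangentMap (m := ∞) le_rfl).continuous)
  ne_zero := by
    intro v hv h0
    apply F.ne_zero _ hv
    change mfderiv 𝓘(ℝ, E') 𝓘(ℝ, E) i v.1 v.2 = 0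
    rw [h0, map_zero]
  smul_mem := by
    intro v hv c hc
    have h := F.smul_mem _ hv c hc
    change (⟨i v.1, mfderiv 𝓘(ℝ, E') 𝓘(ℝ, E) i v.1 (c • v.2)⟩ : TangentBundle 𝓘(ℝ, E) M) ∈ F.dom
    rw [map_smul]
    exact h
  smooth := F.smooth.comp (hi.smooth.contMDiff_tangentMap (m := ∞) le_rfl).contMDiffOn
    (fun _ h => h)
  homogeneous := by
    intro v hv c hc
    have h := F.homogeneous _ hv c hc
    change F.L (⟨i v.1, mfderiv 𝓘(ℝ, E') 𝓘(ℝ, E) i v.1 (c • v.2)⟩ : TangentBundle 𝓘(ℝ, E) M) = _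
    rw [map_smul]
    exact h
  nondegenerate := by
    intro v hv u hu
    apply hi.immersion v.1
    rw [map_zero]
    apply hi.nondegenerate v hv u
    intro w
    rw [← hu w]
    exact (PseudoFinsler.fundForm_comp
      (fun y : TangentSpace 𝓘(ℝ, E) (i v.1) => F.L ⟨i v.1, y⟩)
      (mfderiv 𝓘(ℝ, E') 𝓘(ℝ, E) i v.1).toLinearMap v.2 u w).symm

/-- `S` is totally geodesic in `(M, L)`: the geodesics of `(S, L|_S)` (defined on arbitrary open
intervals) are geodesics of `(M, L)`. -/
def IsTotallyGeodesic (F : PseudoFinslerMetric E M) (i : S → M)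
    (hi : F.IsNondegenerateSubmanifold (E' := E') i) : Prop :=
  ∀ (γ : ℝ → S) (J : Set ℝ), IsOpen J → J.OrdConnected →
    (F.restrict i hi).IsGeodesicOn γ J → F.IsGeodesicOn (fun t => i (γ t)) J

end Submanifold

end PseudoFinslerMetric

end

/-! ### Local theory: spray, nonlinear connection and Koszul symbols of a coordinate metric. -/

noncomputable section

open Filter Topology

namespace PseudoFinsler

section LocalMetric

set_option maxSynthPendingDepth 3

variable {E : Type*} [NormedAddCommGroup E] [NormedSpace ℝ E]

/-! The flag curvature only sees the curvature tensor contracted with its flagpole, and this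
contraction depends on nothing but the geodesic spray and the fundamental tensor. Let θ =
`legendre`, so that θ_v = g_v(·, v); let N be half the vertical derivative of the spray and hX = (X,
-N(X)) the horizontal lift. The Chern symbols satisfy Γ_v(X, v) = N_v(X), and the Cartan tensor
vanishes on the flagpole. Hence g_v(∇_X T, v) = hX(g(T, v)) (`fundMap_anisoDeriv_self`) and g(Γ(Y,
Z), v) = (hY θ)(Z) (`fderiv_legendre_horLift`). Antisymmetrising, g_v(R_v(X, Y)Z, v) is the
derivative of θ(Z) along the vertical vector [hX, hY], which is minus g_v of Z and the curvature of
N (`fundMap_coordCurvature_self`).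

Total geodesy enters through sprays. Every v in TS ∩ A is the initial velocity of a geodesic of S;
this curve also solves the ambient equation, and comparing accelerations shows that the ambient
spray along TS is the second-order push-forward of the spray of S
(`IsTotallyGeodesic.sprayRelatedAt`). Differentiating this relation vertically, and then along
horizontal lifts, relates the nonlinear connections and their curvatures
(`sprayCurvature_of_sprayRelated`). Since g on S is the pull-back of g on M, numerators and
denominators of the two flag curvatures agree. Neither a second fundamental form nor a comparison of
the full Chern symbols is needed. -/

/-- `l` is, on the open set `U`, the coordinate expression of a pseudo-Finsler metric. -/
structure IsCoordMetric (l : E × E → ℝ) (U : Set (E × E)) : Prop where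
  isOpen : IsOpen U
  smooth : ∀ z ∈ U, ContDiffAt ℝ ∞ l z
  homogeneous : ∀ z ∈ U, ∀ c : ℝ, 0 < c → l (z.1, c • z.2) = c ^ 2 * l z
  nondegenerate : ∀ z ∈ U, ∀ u : E, (∀ w : E, coordFund l z u w = 0) → u = 0

/-- Half the vertical derivative of `l`. -/
def legendre (l : E × E → ℝ) (z : E × E) : E →L[ℝ] ℝ :=
  (1 / 2 : ℝ) • (fderiv ℝ l z).comp (ContinuousLinearMap.inr ℝ E E)

/-- The fundamental tensor as a continuous bilinear map. -/
def fundMap (l : E × E → ℝ) (z : E × E) : E →L[ℝ] E →L[ℝ] ℝ :=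
  (fderiv ℝ (legendre l) z).comp (ContinuousLinearMap.inr ℝ E E)

/-- The right-hand side of the Euler-Lagrange equations. -/
def lagrangeForce (l : E × E → ℝ) (z : E × E) : E →L[ℝ] ℝ :=
  fderiv ℝ (legendre l) z (z.2, 0) -
    (1 / 2 : ℝ) • (fderiv ℝ l z).comp (ContinuousLinearMap.inl ℝ E E)

/-- The spray coefficients: geodesics are the solutions of `x'' = -spray (x, x')`. -/
def spray (l : E × E → ℝ) (z : E × E) : E :=
  (fundMap l z).inverse (lagrangeForce l z)

/-- The nonlinear connection defined by the spray. -/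
def nonlinConn (l : E × E → ℝ) (z : E × E) : E →L[ℝ] E :=
  (1 / 2 : ℝ) • (fderiv ℝ (spray l) z).comp (ContinuousLinearMap.inr ℝ E E)

/-- The horizontal lift. -/
def horLift (l : E × E → ℝ) (z : E × E) : E →L[ℝ] E × E :=
  (ContinuousLinearMap.id ℝ E).prod (-nonlinConn l z)

/-- `(X, Y, Z) ↦` the horizontal derivative in direction `X` of `g (Y, Z)`. -/
def horDerivFund (l : E × E → ℝ) (z : E × E) : E →L[ℝ] E →L[ℝ] E →L[ℝ] ℝ :=
  (fderiv ℝ (fundMap l) z).comp (horLift l z)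

/-- `(X, Y, Z) ↦` the horizontal derivative in direction `Z` of `g (X, Y)`. -/
def horDerivFundRotate (l : E × E → ℝ) (z : E × E) : E →L[ℝ] E →L[ℝ] E →L[ℝ] ℝ :=
  (ContinuousLinearMap.flipₗᵢ ℝ E E ℝ).toContinuousLinearEquiv.toContinuousLinearMap.comp
    (horDerivFund l z).flip

/-- The right-hand side of the Koszul formula. -/
def koszulForm (l : E × E → ℝ) (z : E × E) : E →L[ℝ] E →L[ℝ] E →L[ℝ] ℝ :=
  (1 / 2 : ℝ) • (horDerivFund l z + (horDerivFund l z).flip - horDerivFundRotate l z)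

/-- The Christoffel symbols given by the Koszul formula. -/
def koszulSymbol (l : E × E → ℝ) (z : E × E) : E →L[ℝ] E →L[ℝ] E :=
  (ContinuousLinearMap.compL ℝ E (E →L[ℝ] ℝ) E (fundMap l z).inverse).comp (koszulForm l z)

/-- The curvature of the nonlinear connection. -/
def sprayCurvature (l : E × E → ℝ) (z : E × E) (X Y : E) : E :=
  fderiv ℝ (fun z' => nonlinConn l z' Y) z (horLift l z X) -
    fderiv ℝ (fun z' => nonlinConn l z' X) z (horLift l z Y)

theorem horLift_apply (l : E × E → ℝ) (z : E × E) (X : E) :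
    horLift l z X = (X, -nonlinConn l z X) := rfl

theorem legendre_apply (l : E × E → ℝ) (z : E × E) (w : E) :
    legendre l z w = (1 / 2) * fderiv ℝ l z (0, w) := by
  simp [legendre]

theorem fundMap_apply (l : E × E → ℝ) (z : E × E) (u : E) :
    fundMap l z u = fderiv ℝ (legendre l) z (0, u) := by
  simp [fundMap]

theorem lagrangeForce_apply (l : E × E → ℝ) (z : E × E) (w : E) :
    lagrangeForce l z w =
      fderiv ℝ (legendre l) z (z.2, 0) w - (1 / 2) * fderiv ℝ l z (w, 0) := by
  simp [lagrangeForce]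

theorem nonlinConn_apply (l : E × E → ℝ) (z : E × E) (X : E) :
    nonlinConn l z X = (1 / 2 : ℝ) • fderiv ℝ (spray l) z (0, X) := by
  simp [nonlinConn]

theorem horDerivFund_apply (l : E × E → ℝ) (z : E × E) (X : E) :
    horDerivFund l z X = fderiv ℝ (fundMap l) z (X, -nonlinConn l z X) := rfl

theorem koszulForm_apply (l : E × E → ℝ) (z : E × E) (X Y Z : E) :
    koszulForm l z X Y Z = (1 / 2) * (horDerivFund l z X Y Z + horDerivFund l z Y X Z -
      horDerivFund l z Z X Y) := by
  have : horDerivFundRotate l z X Y Z = horDerivFund l z Z X Y := rfl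
  simp [koszulForm, this]

theorem koszulSymbol_apply (l : E × E → ℝ) (z : E × E) (X Y : E) :
    koszulSymbol l z X Y = (fundMap l z).inverse (koszulForm l z X Y) := rfl

/-! ### Smoothness -/

section Smooth

variable {l : E × E → ℝ} {z : E × E}

theorem _root_.ContDiffAt.fderiv_infty {E F : Type*} [NormedAddCommGroup E] [NormedSpace ℝ E]
    [NormedAddCommGroup F] [NormedSpace ℝ F] {f : E → F} {x : E} (h : ContDiffAt ℝ ∞ f x) :
    ContDiffAt ℝ ∞ (fderiv ℝ f) x :=
  h.fderiv_right (by simp)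

theorem _root_.ContDiffAt.differentiableAt_infty {E F : Type*} [NormedAddCommGroup E] [NormedSpace ℝ E]
    [NormedAddCommGroup F] [NormedSpace ℝ F] {f : E → F} {x : E} (h : ContDiffAt ℝ ∞ f x) :
    DifferentiableAt ℝ f x :=
  h.differentiableAt (by simp)

theorem _root_.ContDiffAt.fderiv_fderiv_comm {E F : Type*} [NormedAddCommGroup E] [NormedSpace ℝ E]
    [NormedAddCommGroup F] [NormedSpace ℝ F] {f : E → F} {x : E} (h : ContDiffAt ℝ ∞ f x)
    (v w : E) : fderiv ℝ (fderiv ℝ f) x v w = fderiv ℝ (fderiv ℝ f) x w v :=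
  (h.isSymmSndFDerivAt
    (by simpa using WithTop.coe_le_coe.2 (le_top : (2 : ℕ∞) ≤ ⊤))).eq v w

theorem contDiffAt_legendre (h : ContDiffAt ℝ ∞ l z) : ContDiffAt ℝ ∞ (legendre l) z :=
  (h.fderiv_infty.clm_comp contDiffAt_const).const_smul _

theorem contDiffAt_fundMap (h : ContDiffAt ℝ ∞ l z) : ContDiffAt ℝ ∞ (fundMap l) z :=
  (contDiffAt_legendre h).fderiv_infty.clm_comp contDiffAt_const

theorem contDiffAt_lagrangeForce (h : ContDiffAt ℝ ∞ l z) :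
    ContDiffAt ℝ ∞ (lagrangeForce l) z :=
  ((contDiffAt_legendre h).fderiv_infty.clm_apply (contDiffAt_snd.prodMk contDiffAt_const)).sub
    ((h.fderiv_infty.clm_comp contDiffAt_const).const_smul _)

theorem fderiv_legendre_apply (h : ContDiffAt ℝ ∞ l z) (W : E × E) (w : E) :
    fderiv ℝ (legendre l) z W w = (1 / 2) * fderiv ℝ (fderiv ℝ l) z W (0, w) := by
  have h1 : HasFDerivAt (fun z => (fderiv ℝ l z).comp (ContinuousLinearMap.inr ℝ E E)) _ z :=
    h.fderiv_infty.differentiableAt_infty.hasFDerivAt.clm_comp (hasFDerivAt_const _ z)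
  have h2 : HasFDerivAt (legendre l) _ z := h1.const_smul (1 / 2 : ℝ)
  rw [h2.fderiv]
  simp

/-- Evaluation commutes with differentiation. -/
theorem fderiv_clm_const {E F G : Type*} [NormedAddCommGroup E] [NormedSpace ℝ E]
    [NormedAddCommGroup F] [NormedSpace ℝ F] [NormedAddCommGroup G] [NormedSpace ℝ G]
    {f : E → F →L[ℝ] G} {x : E} (h : DifferentiableAt ℝ f x) (w : F) (v : E) :
    fderiv ℝ (fun x => f x w) x v = fderiv ℝ f x v w := by
  rw [fderiv_clm_apply h (differentiableAt_const w)]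
  simp

theorem fundMap_symm (h : ContDiffAt ℝ ∞ l z) (u w : E) : fundMap l z u w = fundMap l z w u := by
  rw [fundMap_apply, fundMap_apply, fderiv_legendre_apply h, fderiv_legendre_apply h,
    h.fderiv_fderiv_comm]

theorem fderiv_fundMap_apply (h : ContDiffAt ℝ ∞ l z) (W : E × E) (u : E) :
    fderiv ℝ (fundMap l) z W u = fderiv ℝ (fderiv ℝ (legendre l)) z W (0, u) := by
  have h1 : HasFDerivAt (fundMap l) _ z :=
    (contDiffAt_legendre h).fderiv_infty.differentiableAt_infty.hasFDerivAt.clm_comp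
      (hasFDerivAt_const (ContinuousLinearMap.inr ℝ E E) z)
  rw [h1.fderiv]
  simp

/-- Second derivatives of `legendre` commute; with the symmetry of g this makes the Cartan tensor
totally symmetric. -/
theorem fderiv_fundMap_vert_comm (h : ContDiffAt ℝ ∞ l z) (a b : E) :
    fderiv ℝ (fundMap l) z (0, a) b = fderiv ℝ (fundMap l) z (0, b) a := by
  rw [fderiv_fundMap_apply h, fderiv_fundMap_apply h,
    (contDiffAt_legendre h).fderiv_fderiv_comm]

end Smooth

namespace IsCoordMetric

variable {l : E × E → ℝ} {U : Set (E × E)} {z : E × E}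

theorem eventually_mem (hl : IsCoordMetric l U) (hz : z ∈ U) : ∀ᶠ z' in 𝓝 z, z' ∈ U :=
  hl.isOpen.mem_nhds hz

theorem fderiv_fundMap_symm (hl : IsCoordMetric l U) (hz : z ∈ U) (W : E × E) (u w : E) :
    fderiv ℝ (fundMap l) z W u w = fderiv ℝ (fundMap l) z W w u := by
  have hd := (contDiffAt_fundMap (hl.smooth z hz)).differentiableAt_infty
  have key : ∀ a b : E, fderiv ℝ (fun z => fundMap l z a b) z W = fderiv ℝ (fundMap l) z W a b := by
    intro a b
    rw [fderiv_clm_const (hd.clm_apply (differentiableAt_const a)), fderiv_clm_const hd]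
  rw [← key, ← key]
  congr 1
  apply Filter.EventuallyEq.fderiv_eq
  filter_upwards [hl.eventually_mem hz] with z' hz' using fundMap_symm (hl.smooth z' hz') u w

theorem coordFund_eq (hl : IsCoordMetric l U) (hz : z ∈ U) (u w : E) :
    coordFund l z u w = fundMap l z u w := by
  have inner : ∀ z' ∈ U, deriv (fun t : ℝ => l (z'.1, z'.2 + t • w)) 0 = fderiv ℝ l z' (0, w) := by
    intro z' hz'
    have hc : HasDerivAt (fun t : ℝ => ((z'.1, z'.2 + t • w) : E × E)) (0, w) 0 := by
      have : HasDerivAt (fun t : ℝ => z'.2 + t • w) w 0 := by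
        simpa using ((hasDerivAt_id (0 : ℝ)).smul_const w).const_add z'.2
      exact (hasDerivAt_const (0 : ℝ) z'.1).prodMk this
    have hd : HasFDerivAt l (fderiv ℝ l z') (z'.1, z'.2 + (0 : ℝ) • w) := by
      simpa using (hl.smooth z' hz').differentiableAt_infty.hasFDerivAt
    exact (hd.comp_hasDerivAt (0 : ℝ) hc).deriv
  have hc : HasDerivAt (fun t : ℝ => ((z.1, z.2 + t • u) : E × E)) (0, u) 0 := by
    have : HasDerivAt (fun t : ℝ => z.2 + t • u) u 0 := by
      simpa using ((hasDerivAt_id (0 : ℝ)).smul_const u).const_add z.2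
    exact (hasDerivAt_const (0 : ℝ) z.1).prodMk this
  have hcU : ∀ᶠ t in 𝓝 (0 : ℝ), ((z.1, z.2 + t • u) : E × E) ∈ U := by
    apply hc.continuousAt.eventually_mem
    apply hl.isOpen.mem_nhds
    simpa using hz
  have hd : HasFDerivAt (fun z' => fderiv ℝ l z' (0, w))
      (fderiv ℝ (fun z' => fderiv ℝ l z' (0, w)) z) (z.1, z.2 + (0 : ℝ) • u) := by
    have h0 : ((z.1, z.2 + (0 : ℝ) • u) : E × E) = z := by simp
    rw [h0]
    exact ((hl.smooth z hz).fderiv_infty.differentiableAt_infty.clm_apply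
      (differentiableAt_const _)).hasFDerivAt
  have outer : deriv (fun s : ℝ => deriv (fun t : ℝ => l (z.1, z.2 + s • u + t • w)) 0) 0 =
      fderiv ℝ (fun z' => fderiv ℝ l z' (0, w)) z (0, u) := by
    rw [← (hd.comp_hasDerivAt (0 : ℝ) hc).deriv]
    apply Filter.EventuallyEq.deriv_eq
    filter_upwards [hcU] with s hs using inner _ hs
  rw [coordFund, fundForm, outer,
    fderiv_clm_const (hl.smooth z hz).fderiv_infty.differentiableAt_infty, fundMap_apply,
    fderiv_legendre_apply (hl.smooth z hz)]

theorem coordFund_hasDerivAt (hl : IsCoordMetric l U) (hz : z ∈ U) (W : E × E) (u w : E) :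
    deriv (fun t : ℝ => coordFund l (z.1 + t • W.1, z.2 + t • W.2) u w) 0 =
      fderiv ℝ (fundMap l) z W u w := by
  have hc : HasDerivAt (fun t : ℝ => ((z.1 + t • W.1, z.2 + t • W.2) : E × E)) W 0 := by
    have h1 : HasDerivAt (fun t : ℝ => z.1 + t • W.1) W.1 0 := by
      simpa using ((hasDerivAt_id (0 : ℝ)).smul_const W.1).const_add z.1
    have h2 : HasDerivAt (fun t : ℝ => z.2 + t • W.2) W.2 0 := by
      simpa using ((hasDerivAt_id (0 : ℝ)).smul_const W.2).const_add z.2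
    exact h1.prodMk h2
  have hcU : ∀ᶠ t in 𝓝 (0 : ℝ), ((z.1 + t • W.1, z.2 + t • W.2) : E × E) ∈ U := by
    apply hc.continuousAt.eventually_mem
    apply hl.isOpen.mem_nhds
    simpa using hz
  have hdf := (contDiffAt_fundMap (hl.smooth z hz)).differentiableAt_infty
  have hd : HasFDerivAt (fun z' => fundMap l z' u w)
      (fderiv ℝ (fun z' => fundMap l z' u w) z) (z.1 + (0 : ℝ) • W.1, z.2 + (0 : ℝ) • W.2) := by
    have h0 : ((z.1 + (0 : ℝ) • W.1, z.2 + (0 : ℝ) • W.2) : E × E) = z := by simp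
    rw [h0]
    exact ((hdf.clm_apply (differentiableAt_const _)).clm_apply
      (differentiableAt_const _)).hasFDerivAt
  rw [← fderiv_clm_const hdf, ← fderiv_clm_const (hdf.clm_apply (differentiableAt_const _)),
    ← (hd.comp_hasDerivAt (0 : ℝ) hc).deriv]
  apply Filter.EventuallyEq.deriv_eq
  filter_upwards [hcU] with s hs using hl.coordFund_eq hs u w

theorem coordCartan_eq (hl : IsCoordMetric l U) (hz : z ∈ U) (u w a : E) :
    2 * coordCartan l z u w a = fderiv ℝ (fundMap l) z (0, a) u w := by
  rw [← hl.coordFund_hasDerivAt hz (0, a), coordCartan, cartanForm]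
  simp [coordFund]

/-! ### Consequences of homogeneity -/

/-- Euler's identity: differentiate l(x, ty) = t² l(x, y) at t = 1. -/
theorem fderiv_vert_self (hl : IsCoordMetric l U) (hz : z ∈ U) :
    fderiv ℝ l z (0, z.2) = 2 * l z := by
  have hc : HasDerivAt (fun t : ℝ => ((z.1, t • z.2) : E × E)) (0, z.2) 1 := by
    have : HasDerivAt (fun t : ℝ => t • z.2) z.2 1 := by
      simpa using (hasDerivAt_id (1 : ℝ)).smul_const z.2
    exact (hasDerivAt_const (1 : ℝ) z.1).prodMk this
  have hd : HasFDerivAt l (fderiv ℝ l z) (z.1, (1 : ℝ) • z.2) := by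
    simpa using (hl.smooth z hz).differentiableAt_infty.hasFDerivAt
  have h1 := hd.comp_hasDerivAt (1 : ℝ) hc
  have h2 : HasDerivAt (fun t : ℝ => t ^ 2 * l z) (2 * l z) 1 := by
    simpa using (hasDerivAt_pow 2 (1 : ℝ)).mul_const (l z)
  refine h1.unique (h2.congr_of_eventuallyEq ?_)
  filter_upwards [lt_mem_nhds (zero_lt_one (α := ℝ))] with t ht using hl.homogeneous z hz t ht

/-- Derivative of Euler's identity θ_z(y) = l(z) along W; the homogeneity identities below all come
from it. -/
theorem fderiv_legendre_self (hl : IsCoordMetric l U) (hz : z ∈ U) (W : E × E) :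
    fderiv ℝ (legendre l) z W z.2 + legendre l z W.2 = fderiv ℝ l z W := by
  have hs := hl.smooth z hz
  have h1 : (fun z' : E × E => legendre l z' z'.2) =ᶠ[𝓝 z] l := by
    filter_upwards [hl.eventually_mem hz] with z' hz'
    rw [legendre_apply, hl.fderiv_vert_self hz']
    ring
  rw [← h1.fderiv_eq, fderiv_clm_apply (contDiffAt_legendre hs).differentiableAt_infty
    differentiableAt_snd]
  simp [fderiv_snd, add_comm]

theorem fundMap_self (hl : IsCoordMetric l U) (hz : z ∈ U) (w : E) :
    fundMap l z w z.2 = legendre l z w := by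
  have h := hl.fderiv_legendre_self hz (0, w)
  have h2 := legendre_apply l z w
  rw [fundMap_apply]
  simp only at h
  linarith

theorem fderiv_legendre_hor_self (hl : IsCoordMetric l U) (hz : z ∈ U) (x : E) :
    fderiv ℝ (legendre l) z (x, 0) z.2 = fderiv ℝ l z (x, 0) := by
  simpa using hl.fderiv_legendre_self hz (x, 0)

theorem fderiv_fundMap_self (hl : IsCoordMetric l U) (hz : z ∈ U) (W : E × E) (w : E) :
    fderiv ℝ (fundMap l) z W w z.2 = fderiv ℝ (legendre l) z W w - fundMap l z w W.2 := by
  have hs := hl.smooth z hz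
  have hd := (contDiffAt_fundMap hs).differentiableAt_infty
  have h1 : (fun z' : E × E => fundMap l z' w z'.2) =ᶠ[𝓝 z] fun z' => legendre l z' w := by
    filter_upwards [hl.eventually_mem hz] with z' hz' using hl.fundMap_self hz' w
  rw [← fderiv_clm_const (contDiffAt_legendre hs).differentiableAt_infty, ← h1.fderiv_eq,
    fderiv_clm_apply (hd.clm_apply (differentiableAt_const _)) differentiableAt_snd]
  simp [fderiv_snd, fderiv_clm_const hd]

/-- The Cartan tensor annihilates the flagpole. This is what makes the implicit Koszul formula for
the Chern symbols solvable. -/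
theorem fderiv_fundMap_vert_self (hl : IsCoordMetric l U) (hz : z ∈ U) (a w : E) :
    fderiv ℝ (fundMap l) z (0, a) w z.2 = 0 := by
  rw [hl.fderiv_fundMap_self hz, ← fundMap_apply, fundMap_symm (hl.smooth z hz) a w, sub_self]

theorem fderiv_fundMap_vert_self' (hl : IsCoordMetric l U) (hz : z ∈ U) (a w : E) :
    fderiv ℝ (fundMap l) z (0, a) z.2 w = 0 := by
  rw [hl.fderiv_fundMap_symm hz, hl.fderiv_fundMap_vert_self hz]

theorem horDerivFund_symm (hl : IsCoordMetric l U) (hz : z ∈ U) (X Y Z : E) :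
    horDerivFund l z X Y Z = horDerivFund l z X Z Y :=
  hl.fderiv_fundMap_symm hz _ _ _

theorem horDerivFund_eq (X Y Z : E) : horDerivFund l z X Y Z =
    fderiv ℝ (fundMap l) z (X, 0) Y Z - fderiv ℝ (fundMap l) z (0, nonlinConn l z X) Y Z := by
  have : ((X, -nonlinConn l z X) : E × E) = (X, 0) - (0, nonlinConn l z X) := by simp
  rw [horDerivFund_apply, this, map_sub]
  rfl

theorem fderiv_lagrangeForce_vert (hl : IsCoordMetric l U) (hz : z ∈ U) (X w : E) :
    fderiv ℝ (lagrangeForce l) z (0, X) w = fderiv ℝ (fundMap l) z (z.2, 0) X w +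
      fderiv ℝ (fundMap l) z (X, 0) w z.2 - fderiv ℝ (fundMap l) z (w, 0) X z.2 := by
  have hs := hl.smooth z hz
  have hθ := contDiffAt_legendre hs
  have hd1 : HasFDerivAt (fun z : E × E => ((z.2, 0) : E × E))
      ((ContinuousLinearMap.snd ℝ E E).prod 0) z :=
    hasFDerivAt_snd.prodMk (hasFDerivAt_const (0 : E) z)
  have h1 := hθ.fderiv_infty.differentiableAt_infty.hasFDerivAt.clm_apply hd1
  have h2 := (hs.fderiv_infty.differentiableAt_infty.hasFDerivAt.clm_comp
    (hasFDerivAt_const (ContinuousLinearMap.inl ℝ E E) z)).const_smul (1 / 2 : ℝ)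
  have h3 : HasFDerivAt (lagrangeForce l) _ z := h1.sub h2
  rw [h3.fderiv, fderiv_fundMap_apply hs, hl.fderiv_fundMap_self hz, hl.fderiv_fundMap_self hz,
    hθ.fderiv_fderiv_comm (z.2, 0), fderiv_legendre_apply hs (w, 0), hs.fderiv_fderiv_comm (w, 0)]
  simp
  ring

/-- Compatibility with the metric in terms of the derivative of the fundamental tensor. -/
theorem compatible_iff (hl : IsCoordMetric l U) (hz : z ∈ U) (Γ : E →L[ℝ] E →L[ℝ] E)
    (X Y Z : E) :
    (deriv (fun t : ℝ => coordFund l (z.1 + t • X, z.2) Y Z) 0 =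
      coordFund l z (Γ X Y) Z + coordFund l z Y (Γ X Z) + 2 * coordCartan l z (Γ X z.2) Y Z) ↔
    fderiv ℝ (fundMap l) z (X, 0) Y Z = fundMap l z (Γ X Y) Z + fundMap l z Y (Γ X Z) +
      fderiv ℝ (fundMap l) z (0, Γ X z.2) Y Z := by
  have h := hl.coordFund_hasDerivAt hz (X, 0) Y Z
  simp only [smul_zero, add_zero] at h
  rw [h, hl.coordFund_eq hz, hl.coordFund_eq hz, hl.coordCartan_eq hz,
    fderiv_fundMap_vert_comm (hl.smooth z hz) Z, hl.fderiv_fundMap_symm hz _ Z]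

section FiniteDimensional

variable [FiniteDimensional ℝ E]

theorem isInvertible_fundMap (hl : IsCoordMetric l U) (hz : z ∈ U) :
    (fundMap l z).IsInvertible := by
  have hinj : Function.Injective (fundMap l z).toLinearMap := by
    rw [injective_iff_map_eq_zero]
    intro u hu
    apply hl.nondegenerate z hz u
    intro w
    rw [hl.coordFund_eq hz]
    exact congrArg (fun f : E →L[ℝ] ℝ => f w) hu
  have hfin : Module.finrank ℝ E = Module.finrank ℝ (E →L[ℝ] ℝ) := by
    rw [← (LinearMap.toContinuousLinearMap (𝕜 := ℝ) (E := E) (F' := ℝ)).finrank_eq]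
    exact (Subspace.dual_finrank_eq (K := ℝ) (V := E)).symm
  refine ⟨(LinearEquiv.ofInjectiveOfFinrankEq _ hinj hfin).toContinuousLinearEquiv, ?_⟩
  ext; rfl

theorem fundMap_inverse_apply (hl : IsCoordMetric l U) (hz : z ∈ U) (f : E →L[ℝ] ℝ) :
    fundMap l z ((fundMap l z).inverse f) = f :=
  (hl.isInvertible_fundMap hz).self_apply_inverse f

theorem ext_fundMap (hl : IsCoordMetric l U) (hz : z ∈ U) {u u' : E}
    (h : ∀ w, fundMap l z u w = fundMap l z u' w) : u = u' :=
  (hl.isInvertible_fundMap hz).injective (ContinuousLinearMap.ext h)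

theorem contDiffAt_inverse_fundMap (hl : IsCoordMetric l U) (hz : z ∈ U) :
    ContDiffAt ℝ ∞ (fun z => (fundMap l z).inverse) z := by
  have := FiniteDimensional.complete ℝ E
  obtain ⟨e, he⟩ := hl.isInvertible_fundMap hz
  have h := contDiffAt_map_inverse (𝕜 := ℝ) (n := ∞) e
  rw [he] at h
  exact h.comp z (contDiffAt_fundMap (hl.smooth z hz))

theorem contDiffAt_spray (hl : IsCoordMetric l U) (hz : z ∈ U) : ContDiffAt ℝ ∞ (spray l) z :=
  (hl.contDiffAt_inverse_fundMap hz).clm_apply (contDiffAt_lagrangeForce (hl.smooth z hz))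

theorem contDiffAt_nonlinConn (hl : IsCoordMetric l U) (hz : z ∈ U) :
    ContDiffAt ℝ ∞ (nonlinConn l) z :=
  ((hl.contDiffAt_spray hz).fderiv_infty.clm_comp contDiffAt_const).const_smul _

theorem contDiffAt_horLift (hl : IsCoordMetric l U) (hz : z ∈ U) (X : E) :
    ContDiffAt ℝ ∞ (fun z => horLift l z X) z :=
  contDiffAt_const.prodMk ((hl.contDiffAt_nonlinConn hz).clm_apply contDiffAt_const).neg

theorem contDiffAt_horDerivFund (hl : IsCoordMetric l U) (hz : z ∈ U) (X Y Z : E) :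
    ContDiffAt ℝ ∞ (fun z => horDerivFund l z X Y Z) z :=
  (((contDiffAt_fundMap (hl.smooth z hz)).fderiv_infty.clm_apply
    (hl.contDiffAt_horLift hz X)).clm_apply contDiffAt_const).clm_apply contDiffAt_const

/-- A basis of `E` identifies operators on `E` with tuples of values, so smoothness can be tested on
single vectors. -/
theorem contDiffAt_of_clm_apply {F D : Type*} [NormedAddCommGroup F] [NormedSpace ℝ F]
    [NormedAddCommGroup D] [NormedSpace ℝ D] {f : D → E →L[ℝ] F} {x : D}
    (h : ∀ y, ContDiffAt ℝ ∞ (fun x => f x y) x) : ContDiffAt ℝ ∞ f x := by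
  let e₁ := ContinuousLinearEquiv.ofFinrankEq
    (Module.finrank_fin_fun (n := Module.finrank ℝ E) ℝ).symm
  let e₂ := (e₁.arrowCongr (1 : F ≃L[ℝ] F)).trans
    (ContinuousLinearEquiv.piRing (Fin (Module.finrank ℝ E)))
  rw [← Function.id_comp f, ← e₂.symm_comp_self]
  exact e₂.symm.contDiff.contDiffAt.comp x (contDiffAt_pi.mpr fun i => h _)

theorem contDiffAt_koszulSymbol (hl : IsCoordMetric l U) (hz : z ∈ U) (X Y : E) :
    ContDiffAt ℝ ∞ (fun z => koszulSymbol l z X Y) z := by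
  refine (hl.contDiffAt_inverse_fundMap hz).clm_apply (contDiffAt_of_clm_apply fun Z => ?_)
  have : (fun z => koszulForm l z X Y Z) = _ := funext fun z => koszulForm_apply l z X Y Z
  change ContDiffAt ℝ ∞ (fun z => koszulForm l z X Y Z) z
  rw [this]
  exact contDiffAt_const.mul (((hl.contDiffAt_horDerivFund hz X Y Z).add
    (hl.contDiffAt_horDerivFund hz Y X Z)).sub (hl.contDiffAt_horDerivFund hz Z X Y))

/-! ### The Chern symbols -/

theorem fundMap_spray (hl : IsCoordMetric l U) (hz : z ∈ U) :
    fundMap l z (spray l z) = lagrangeForce l z :=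
  hl.fundMap_inverse_apply hz _

theorem fundMap_spray_eq (hl : IsCoordMetric l U) (hz : z ∈ U) (w : E) :
    2 * fundMap l z (spray l z) w = 2 * fderiv ℝ (fundMap l) z (z.2, 0) z.2 w -
      fderiv ℝ (fundMap l) z (w, 0) z.2 z.2 := by
  rw [hl.fundMap_spray hz, lagrangeForce_apply, hl.fderiv_fundMap_symm hz (z.2, 0),
    hl.fderiv_fundMap_self hz, hl.fderiv_fundMap_self hz, hl.fderiv_legendre_hor_self hz]
  simp
  ring

/-- Vertical derivative of the equation defining the spray; the last term arises from
differentiating g itself. -/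
theorem fundMap_nonlinConn (hl : IsCoordMetric l U) (hz : z ∈ U) (X w : E) :
    2 * fundMap l z (nonlinConn l z X) w = fderiv ℝ (fundMap l) z (z.2, 0) X w +
      fderiv ℝ (fundMap l) z (X, 0) w z.2 - fderiv ℝ (fundMap l) z (w, 0) X z.2 -
      fderiv ℝ (fundMap l) z (0, spray l z) X w := by
  have hs := hl.smooth z hz
  have h1 : (fun z => fundMap l z (spray l z)) =ᶠ[𝓝 z] lagrangeForce l := by
    filter_upwards [hl.eventually_mem hz] with z' hz' using hl.fundMap_spray hz'
  have h2 := h1.fderiv_eq (𝕜 := ℝ)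
  rw [fderiv_clm_apply (contDiffAt_fundMap hs).differentiableAt_infty
    (hl.contDiffAt_spray hz).differentiableAt_infty] at h2
  have h3 := congrArg (fun f : E × E →L[ℝ] E →L[ℝ] ℝ => f (0, X) w) h2
  simp only [add_apply, ContinuousLinearMap.comp_apply,
    ContinuousLinearMap.flip_apply, hl.fderiv_lagrangeForce_vert hz] at h3
  have h4 : ∀ a : E, fundMap l z ((1 / 2 : ℝ) • a) w = (1 / 2) * fundMap l z a w := by simp
  rw [← h3, nonlinConn_apply, h4, fderiv_fundMap_vert_comm hs (spray l z) X]
  ring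

/-- Euler's identity for the 2-homogeneous spray, read off from `fundMap_nonlinConn` at X = y, where
the Cartan term drops out. -/
theorem nonlinConn_self (hl : IsCoordMetric l U) (hz : z ∈ U) :
    nonlinConn l z z.2 = spray l z := by
  apply hl.ext_fundMap hz
  intro w
  have h1 := hl.fundMap_nonlinConn hz z.2 w
  have h2 := hl.fundMap_spray_eq hz w
  rw [hl.fderiv_fundMap_vert_self' hz, hl.fderiv_fundMap_symm hz _ w] at h1
  linarith

theorem fundMap_koszulSymbol (hl : IsCoordMetric l U) (hz : z ∈ U) (X Y Z : E) :
    fundMap l z (koszulSymbol l z X Y) Z = (1 / 2) * (horDerivFund l z X Y Z +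
      horDerivFund l z Y X Z - horDerivFund l z Z X Y) := by
  rw [koszulSymbol_apply, hl.fundMap_inverse_apply hz, koszulForm_apply]

/-- With y as an argument, the only surviving Cartan term in the Koszul formula is the one along
N(y), which is the spray; what remains is the formula for N. -/
theorem koszulSymbol_self (hl : IsCoordMetric l U) (hz : z ∈ U) (X : E) :
    koszulSymbol l z X z.2 = nonlinConn l z X := by
  apply hl.ext_fundMap hz
  intro w
  have h1 := hl.fundMap_nonlinConn hz X w
  rw [hl.fundMap_koszulSymbol hz]
  simp only [horDerivFund_eq, hl.fderiv_fundMap_vert_self hz, hl.fderiv_fundMap_vert_self' hz,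
    hl.nonlinConn_self hz]
  rw [hl.fderiv_fundMap_symm hz _ w] at h1
  linarith

theorem horDerivFund_eq_koszulSymbol (hl : IsCoordMetric l U) (hz : z ∈ U) (X Y Z : E) :
    horDerivFund l z X Y Z =
      fundMap l z (koszulSymbol l z X Y) Z + fundMap l z Y (koszulSymbol l z X Z) := by
  rw [fundMap_symm (hl.smooth z hz) Y, hl.fundMap_koszulSymbol hz, hl.fundMap_koszulSymbol hz]
  rw [hl.horDerivFund_symm hz Z X Y, hl.horDerivFund_symm hz Y X Z, hl.horDerivFund_symm hz X Y Z,
    hl.horDerivFund_symm hz Z Y X, hl.horDerivFund_symm hz Y Z X]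
  ring

theorem koszulSymbol_symm (hl : IsCoordMetric l U) (hz : z ∈ U) (X Y : E) :
    koszulSymbol l z X Y = koszulSymbol l z Y X := by
  apply hl.ext_fundMap hz
  intro w
  rw [hl.fundMap_koszulSymbol hz, hl.fundMap_koszulSymbol hz, hl.horDerivFund_symm hz w]
  ring

theorem isChernSymbol_koszulSymbol (hl : IsCoordMetric l U) (hz : z ∈ U) :
    IsChernSymbol l z (koszulSymbol l z) where
  torsion_free := hl.koszulSymbol_symm hz
  compatible X Y Z := by
    rw [hl.compatible_iff hz, ← hl.horDerivFund_eq_koszulSymbol hz, hl.koszulSymbol_self hz,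
      horDerivFund_eq]
    ring

/-- Permuting the compatibility equations leaves Cartan terms that still contain Γ(·, y). They are
resolved in stages: on (y, y) they vanish, giving the spray; on (X, y) only Γ(y, y) occurs, giving
N; in general only N occurs, giving the Koszul symbol. -/
theorem eq_koszulSymbol (hl : IsCoordMetric l U) (hz : z ∈ U) {Γ : E →L[ℝ] E →L[ℝ] E}
    (h : IsChernSymbol l z Γ) : Γ = koszulSymbol l z := by
  have hs := hl.smooth z hz
  have comp := fun X Y Z => (hl.compatible_iff hz Γ X Y Z).1 (h.compatible X Y Z)
  have tf := h.torsion_free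
  have koszul : ∀ X Y Z : E, 2 * fundMap l z (Γ X Y) Z =
      (fderiv ℝ (fundMap l) z (X, 0) Y Z - fderiv ℝ (fundMap l) z (0, Γ X z.2) Y Z) +
      (fderiv ℝ (fundMap l) z (Y, 0) X Z - fderiv ℝ (fundMap l) z (0, Γ Y z.2) X Z) -
      (fderiv ℝ (fundMap l) z (Z, 0) X Y - fderiv ℝ (fundMap l) z (0, Γ Z z.2) X Y) := by
    intro X Y Z
    rw [comp X Y Z, comp Y X Z, comp Z X Y, tf Y X, tf Z X, tf Z Y, fundMap_symm hs Y,
      fundMap_symm hs X]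
    ring
  have hself : Γ z.2 z.2 = spray l z := by
    apply hl.ext_fundMap hz
    intro w
    have h1 := koszul z.2 z.2 w
    have h2 := hl.fundMap_spray_eq hz w
    simp only [hl.fderiv_fundMap_vert_self' hz] at h1
    linarith
  have hN : ∀ X, Γ X z.2 = nonlinConn l z X := by
    intro X
    apply hl.ext_fundMap hz
    intro w
    have h1 := koszul X z.2 w
    have h2 := hl.fundMap_nonlinConn hz X w
    rw [hl.fderiv_fundMap_symm hz _ w] at h2
    simp only [hl.fderiv_fundMap_vert_self' hz, hl.fderiv_fundMap_vert_self hz, hself] at h1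
    linarith
  ext X Y
  apply hl.ext_fundMap hz
  intro Z
  have h1 := koszul X Y Z
  rw [hl.fundMap_koszulSymbol hz]
  simp only [horDerivFund_eq, ← hN]
  linarith

theorem chernSymbol_eq (hl : IsCoordMetric l U) (hz : z ∈ U) :
    chernSymbol l z = koszulSymbol l z := by
  have hex : ∃! Γ : E →L[ℝ] E →L[ℝ] E, IsChernSymbol l z Γ :=
    ⟨koszulSymbol l z, hl.isChernSymbol_koszulSymbol hz, fun Γ h => hl.eq_koszulSymbol hz h⟩
  rw [chernSymbol, dif_pos hex]
  exact hl.eq_koszulSymbol hz hex.exists.choose_spec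

theorem chernSymbol_self_self (hl : IsCoordMetric l U) (hz : z ∈ U) :
    chernSymbol l z z.2 z.2 = spray l z := by
  rw [hl.chernSymbol_eq hz, hl.koszulSymbol_self hz, hl.nonlinConn_self hz]

end FiniteDimensional

end IsCoordMetric

end LocalMetric

end PseudoFinsler

end

/-! ### The curvature contracted with the flagpole. -/

noncomputable section

open Filter Topology

namespace PseudoFinsler

section CurvatureFormula

set_option maxSynthPendingDepth 3

variable {E : Type*} [NormedAddCommGroup E] [NormedSpace ℝ E] [FiniteDimensional ℝ E]
  {l : E × E → ℝ} {U : Set (E × E)} {z : E × E}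

namespace IsCoordMetric

/-- Differentiate θ(Z) = g(Z, y) along hX: the variation -N(X) of y cancels the metric term g(Z,
Γ(X, y)). -/
theorem fderiv_legendre_horLift (hl : IsCoordMetric l U) (hz : z ∈ U) (X Z : E) :
    fderiv ℝ (legendre l) z (horLift l z X) Z = fundMap l z (koszulSymbol l z X Z) z.2 := by
  have h1 := hl.fderiv_fundMap_self hz (horLift l z X) Z
  have h2 := hl.horDerivFund_eq_koszulSymbol hz X Z z.2
  rw [hl.koszulSymbol_self hz] at h2
  rw [horLift_apply] at h1 ⊢
  rw [horDerivFund_apply, h1, map_neg] at h2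
  linarith

/-- The derivative of an anisotropic vector field, contracted with the flagpole. -/
theorem fundMap_anisoDeriv_self (hl : IsCoordMetric l U) (hz : z ∈ U) {T : E × E → E}
    (hT : DifferentiableAt ℝ T z) (X : E) :
    fundMap l z (coordAnisoDeriv l T z X) z.2 =
      fderiv ℝ (fun z' => fundMap l z' (T z') z'.2) z (horLift l z X) := by
  have hd := (contDiffAt_fundMap (hl.smooth z hz)).differentiableAt_infty
  have h1 := (hd.hasFDerivAt.clm_apply hT.hasFDerivAt).clm_apply (hasFDerivAt_snd (p := z))
  have h2 := hl.horDerivFund_eq_koszulSymbol hz X (T z) z.2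
  rw [h1.fderiv, coordAnisoDeriv, hl.chernSymbol_eq hz, hl.koszulSymbol_self hz]
  rw [hl.koszulSymbol_self hz, horDerivFund_apply] at h2
  simp [horLift_apply, h2]
  ring

/-- Product rule applied to `fderiv_legendre_horLift`; the second term comes from the varying
component -N(Y) of the lift hY. -/
theorem fderiv_fderiv_legendre_horLift (hl : IsCoordMetric l U) (hz : z ∈ U) (X Y Z : E) :
    fderiv ℝ (fun z' => fundMap l z' (koszulSymbol l z' Y Z) z'.2) z (horLift l z X) =
      fderiv ℝ (fderiv ℝ (legendre l)) z (horLift l z X) (horLift l z Y) Z -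
        fundMap l z (fderiv ℝ (fun z' => nonlinConn l z' Y) z (horLift l z X)) Z := by
  have h1 : (fun z' => fundMap l z' (koszulSymbol l z' Y Z) z'.2) =ᶠ[𝓝 z]
      fun z' => fderiv ℝ (legendre l) z' (horLift l z' Y) Z := by
    filter_upwards [hl.eventually_mem hz] with z' hz'
      using (hl.fderiv_legendre_horLift hz' Y Z).symm
  have hd := (contDiffAt_legendre (hl.smooth z hz)).fderiv_infty.differentiableAt_infty
  have hN : DifferentiableAt ℝ (fun z' => nonlinConn l z' Y) z :=
    ((hl.contDiffAt_nonlinConn hz).clm_apply contDiffAt_const).differentiableAt_infty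
  have hh : HasFDerivAt (fun z' => horLift l z' Y) _ z :=
    (hasFDerivAt_const Y z).prodMk hN.hasFDerivAt.neg
  have h2 := (hd.hasFDerivAt.clm_apply hh).clm_apply (hasFDerivAt_const Z z)
  rw [h1.fderiv_eq, h2.fderiv]
  simp [← fundMap_apply]
  ring

/-- After antisymmetrisation the Hessian of θ disappears and only the derivatives of N are left. -/
theorem fundMap_coordCurvature_self (hl : IsCoordMetric l U) (hz : z ∈ U) (X Y Z : E) :
    fundMap l z (coordCurvature l z X Y Z) z.2 = -fundMap l z (sprayCurvature l z X Y) Z := by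
  have key : ∀ X Y : E, fundMap l z (coordAnisoDeriv l (fun z' => chernSymbol l z' Y Z) z X) z.2 =
      fderiv ℝ (fderiv ℝ (legendre l)) z (horLift l z X) (horLift l z Y) Z -
        fundMap l z (fderiv ℝ (fun z' => nonlinConn l z' Y) z (horLift l z X)) Z := by
    intro X Y
    -- The two symbols are known to agree only on `U`; equality of germs suffices, since only the
    -- value and first derivative at z enter.
    have h1 : (fun z' => chernSymbol l z' Y Z) =ᶠ[𝓝 z] fun z' => koszulSymbol l z' Y Z := by
      filter_upwards [hl.eventually_mem hz] with z' hz'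
      rw [hl.chernSymbol_eq hz']
    have h2 : coordAnisoDeriv l (fun z' => chernSymbol l z' Y Z) z X =
        coordAnisoDeriv l (fun z' => koszulSymbol l z' Y Z) z X := by
      rw [coordAnisoDeriv, coordAnisoDeriv, h1.fderiv_eq, h1.eq_of_nhds]
    rw [h2, hl.fundMap_anisoDeriv_self hz
      (hl.contDiffAt_koszulSymbol hz Y Z).differentiableAt_infty,
      hl.fderiv_fderiv_legendre_horLift hz]
  rw [coordCurvature, map_sub, sub_apply, key, key, sprayCurvature,
    map_sub, sub_apply,
    (contDiffAt_legendre (hl.smooth z hz)).fderiv_fderiv_comm]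
  ring

end IsCoordMetric

end CurvatureFormula

/-! ### Naturality under smooth maps -/

section Naturality

set_option maxSynthPendingDepth 3

variable {E : Type*} [NormedAddCommGroup E] [NormedSpace ℝ E]
  {E' : Type*} [NormedAddCommGroup E'] [NormedSpace ℝ E']

/-- The tangent map in coordinates. -/
def tangentLift (φ : E' → E) (z : E' × E') : E × E := (φ z.1, fderiv ℝ φ z.1 z.2)

theorem tangentLift_hasFDerivAt {φ : E' → E} {z : E' × E'} (hφ : ContDiffAt ℝ ∞ φ z.1) :
    HasFDerivAt (tangentLift φ)
      (((fderiv ℝ φ z.1).comp (ContinuousLinearMap.fst ℝ E' E')).prod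
        (((fderiv ℝ φ z.1).comp (ContinuousLinearMap.snd ℝ E' E')) +
          ((fderiv ℝ (fderiv ℝ φ) z.1).comp (ContinuousLinearMap.fst ℝ E' E')).flip z.2)) z := by
  have h1 : HasFDerivAt (fun z : E' × E' => φ z.1) _ z :=
    hφ.differentiableAt_infty.hasFDerivAt.comp z hasFDerivAt_fst
  have h2 : HasFDerivAt (fun z : E' × E' => fderiv ℝ φ z.1) _ z :=
    hφ.fderiv_infty.differentiableAt_infty.hasFDerivAt.comp z hasFDerivAt_fst
  exact h1.prodMk (h2.clm_apply hasFDerivAt_snd)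

theorem fderiv_tangentLift {φ : E' → E} {z : E' × E'} (hφ : ContDiffAt ℝ ∞ φ z.1) (W : E' × E') :
    fderiv ℝ (tangentLift φ) z W =
      (fderiv ℝ φ z.1 W.1, fderiv ℝ φ z.1 W.2 + fderiv ℝ (fderiv ℝ φ) z.1 W.1 z.2) := by
  rw [(tangentLift_hasFDerivAt hφ).fderiv]
  simp

theorem tangentLift_continuousAt {φ : E' → E} {z : E' × E'} (hφ : ContDiffAt ℝ ∞ φ z.1) :
    ContinuousAt (tangentLift φ) z :=
  (tangentLift_hasFDerivAt hφ).continuousAt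

theorem eventually_contDiffAt_fst {φ : E' → E} {s : Set E'} (hs : IsOpen s)
    (hφ : ContDiffOn ℝ ∞ φ s) {z : E' × E'} (hz : z.1 ∈ s) :
    ∀ᶠ z' in 𝓝 z, ContDiffAt ℝ ∞ φ z'.1 :=
  continuous_fst.continuousAt.eventually
    (Filter.mem_of_superset (hs.mem_nhds hz) fun _ hx => hφ.contDiffAt (hs.mem_nhds hx))

variable {l : E × E → ℝ} {U : Set (E × E)} {l' : E' × E' → ℝ} {U' : Set (E' × E')} {φ : E' → E}
  {z : E' × E'}

theorem fderiv_comp_tangentLift (hl : IsCoordMetric l U) (hφ : ContDiffAt ℝ ∞ φ z.1)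
    (hΦ : tangentLift φ z ∈ U) (heq : l' =ᶠ[𝓝 z] l ∘ tangentLift φ) (W : E' × E') :
    fderiv ℝ l' z W = fderiv ℝ l (tangentLift φ z) (fderiv ℝ (tangentLift φ) z W) := by
  rw [heq.fderiv_eq, fderiv_comp z (hl.smooth _ hΦ).differentiableAt_infty
    (tangentLift_hasFDerivAt hφ).differentiableAt]
  rfl

theorem legendre_comp_tangentLift (hl : IsCoordMetric l U) (hφ : ContDiffAt ℝ ∞ φ z.1)
    (hΦ : tangentLift φ z ∈ U) (heq : l' =ᶠ[𝓝 z] l ∘ tangentLift φ) (w : E') :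
    legendre l' z w = legendre l (tangentLift φ z) (fderiv ℝ φ z.1 w) := by
  rw [legendre_apply, legendre_apply, fderiv_comp_tangentLift hl hφ hΦ heq, fderiv_tangentLift hφ]
  simp

variable {s : Set E'}

/-- Product rule; the D²φ term appears because Dφ(w) varies with the base point. For vertical W it
vanishes, which makes g tensorial. -/
theorem fderiv_legendre_comp_tangentLift (hl : IsCoordMetric l U) (hl' : IsCoordMetric l' U')
    (hz : z ∈ U') (hs : IsOpen s) (hφ : ContDiffOn ℝ ∞ φ s) (hzs : z.1 ∈ s)
    (hΦ : tangentLift φ z ∈ U) (heq : l' =ᶠ[𝓝 z] l ∘ tangentLift φ) (W : E' × E') (w : E') :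
    fderiv ℝ (legendre l') z W w =
      fderiv ℝ (legendre l) (tangentLift φ z) (fderiv ℝ (tangentLift φ) z W) (fderiv ℝ φ z.1 w) +
        legendre l (tangentLift φ z) (fderiv ℝ (fderiv ℝ φ) z.1 W.1 w) := by
  have hφz := hφ.contDiffAt (hs.mem_nhds hzs)
  have h1 : (fun z' => legendre l' z' w) =ᶠ[𝓝 z]
      fun z' => legendre l (tangentLift φ z') (fderiv ℝ φ z'.1 w) := by
    filter_upwards [eventually_contDiffAt_fst hs hφ hzs, heq.eventuallyEq_nhds,
      (tangentLift_continuousAt hφz).eventually (hl.eventually_mem hΦ)] with z' h1 h2 h3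
      using legendre_comp_tangentLift hl h1 h3 h2 w
  have h2 : HasFDerivAt (fun z' => legendre l (tangentLift φ z')) _ z :=
    (contDiffAt_legendre (hl.smooth _ hΦ)).differentiableAt_infty.hasFDerivAt.comp z
      (tangentLift_hasFDerivAt hφz)
  have h3 : HasFDerivAt (fun z : E' × E' => fderiv ℝ φ z.1) _ z :=
    hφz.fderiv_infty.differentiableAt_infty.hasFDerivAt.comp z hasFDerivAt_fst
  have h4 := h2.clm_apply (h3.clm_apply (hasFDerivAt_const w z))
  rw [← fderiv_clm_const (contDiffAt_legendre (hl'.smooth z hz)).differentiableAt_infty,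
    h1.fderiv_eq, h4.fderiv, (tangentLift_hasFDerivAt hφz).fderiv]
  simp
  ring

theorem fundMap_comp_tangentLift (hl : IsCoordMetric l U) (hl' : IsCoordMetric l' U')
    (hz : z ∈ U') (hs : IsOpen s) (hφ : ContDiffOn ℝ ∞ φ s) (hzs : z.1 ∈ s)
    (hΦ : tangentLift φ z ∈ U) (heq : l' =ᶠ[𝓝 z] l ∘ tangentLift φ) (u w : E') :
    fundMap l' z u w =
      fundMap l (tangentLift φ z) (fderiv ℝ φ z.1 u) (fderiv ℝ φ z.1 w) := by
  rw [fundMap_apply, fundMap_apply, fderiv_legendre_comp_tangentLift hl hl' hz hs hφ hzs hΦ heq,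
    fderiv_tangentLift (hφ.contDiffAt (hs.mem_nhds hzs))]
  simp

/-- The Euler-Lagrange operator is natural. -/
theorem lagrangeForce_comp_tangentLift (hl : IsCoordMetric l U) (hl' : IsCoordMetric l' U')
    (hz : z ∈ U') (hs : IsOpen s) (hφ : ContDiffOn ℝ ∞ φ s) (hzs : z.1 ∈ s)
    (hΦ : tangentLift φ z ∈ U) (heq : l' =ᶠ[𝓝 z] l ∘ tangentLift φ) (w : E') :
    lagrangeForce l' z w = lagrangeForce l (tangentLift φ z) (fderiv ℝ φ z.1 w) +
      fundMap l (tangentLift φ z) (fderiv ℝ (fderiv ℝ φ) z.1 z.2 z.2) (fderiv ℝ φ z.1 w) := by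
  have hφz := hφ.contDiffAt (hs.mem_nhds hzs)
  have split : ∀ (f : E × E →L[ℝ] ℝ) (a b : E), f (a, b) = f (a, 0) + f (0, b) := by
    intro f a b
    rw [← map_add]
    simp
  have split' : ∀ (f : E × E →L[ℝ] E →L[ℝ] ℝ) (a b : E), f (a, b) = f (a, 0) + f (0, b) := by
    intro f a b
    rw [← map_add]
    simp
  rw [lagrangeForce_apply, lagrangeForce_apply, fundMap_apply,
    fderiv_legendre_comp_tangentLift hl hl' hz hs hφ hzs hΦ heq,
    fderiv_comp_tangentLift hl hφz hΦ heq, fderiv_tangentLift hφz, fderiv_tangentLift hφz]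
  simp only [map_zero, zero_add]
  -- The terms θ(D²φ(y, w)) and θ(D²φ(w, y)), from the two halves of the Euler-Lagrange expression,
  -- cancel by symmetry of D²φ.
  rw [split, split' _ _ (fderiv ℝ (fderiv ℝ φ) z.1 z.2 z.2), legendre_apply,
    hφz.fderiv_fderiv_comm w z.2, add_apply]
  simp only [tangentLift]
  ring

/-- The spray of `l` at the image of `z` is the second-order push-forward of the spray of `l'`. -/
def SprayRelatedAt (l' : E' × E' → ℝ) (l : E × E → ℝ) (φ : E' → E) (z : E' × E') : Prop :=
  spray l (tangentLift φ z) =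
    fderiv ℝ φ z.1 (spray l' z) - fderiv ℝ (fderiv ℝ φ) z.1 z.2 z.2

/-- Naturality of the Euler-Lagrange operator tests the relation only against the image of Dφ.
Surjectivity, as for chart changes, makes this enough; for a submanifold total geodesy must supply
the missing components. -/
theorem sprayRelatedAt_of_surjective [FiniteDimensional ℝ E] [FiniteDimensional ℝ E']
    (hl : IsCoordMetric l U) (hl' : IsCoordMetric l' U')
    (hz : z ∈ U') (hs : IsOpen s) (hφ : ContDiffOn ℝ ∞ φ s) (hzs : z.1 ∈ s)
    (hΦ : tangentLift φ z ∈ U) (heq : l' =ᶠ[𝓝 z] l ∘ tangentLift φ)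
    (hsurj : Function.Surjective (fderiv ℝ φ z.1)) : SprayRelatedAt l' l φ z := by
  apply hl.ext_fundMap hΦ
  intro w'
  obtain ⟨w, rfl⟩ := hsurj w'
  have h1 := lagrangeForce_comp_tangentLift hl hl' hz hs hφ hzs hΦ heq w
  rw [← hl.fundMap_spray hΦ, ← hl'.fundMap_spray hz,
    fundMap_comp_tangentLift hl hl' hz hs hφ hzs hΦ heq] at h1
  rw [map_sub, sub_apply, h1]
  ring

section Curvature

variable [FiniteDimensional ℝ E] [FiniteDimensional ℝ E']

/-- Derivative of the spray relation along (0, u), which the tangent lift sends to (0, Dφ u). So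
knowing the ambient spray on the image is enough, but only for arguments in the image of Dφ. -/
theorem nonlinConn_of_sprayRelated (hl : IsCoordMetric l U) (hl' : IsCoordMetric l' U')
    (hz : z ∈ U') (hφ : ContDiffAt ℝ ∞ φ z.1) (hΦ : tangentLift φ z ∈ U)
    (hrel : ∀ᶠ z' in 𝓝 z, SprayRelatedAt l' l φ z') (u : E') :
    nonlinConn l (tangentLift φ z) (fderiv ℝ φ z.1 u) =
      fderiv ℝ φ z.1 (nonlinConn l' z u) - fderiv ℝ (fderiv ℝ φ) z.1 u z.2 := by
  have h1 : HasFDerivAt (fun z' => spray l (tangentLift φ z')) _ z :=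
    (hl.contDiffAt_spray hΦ).differentiableAt_infty.hasFDerivAt.comp z
      (tangentLift_hasFDerivAt hφ)
  have h2 : HasFDerivAt (fun z : E' × E' => fderiv ℝ φ z.1) _ z :=
    hφ.fderiv_infty.differentiableAt_infty.hasFDerivAt.comp z hasFDerivAt_fst
  have h3 : HasFDerivAt (fun z : E' × E' => fderiv ℝ (fderiv ℝ φ) z.1) _ z :=
    hφ.fderiv_infty.fderiv_infty.differentiableAt_infty.hasFDerivAt.comp z hasFDerivAt_fst
  have h4 := (h2.clm_apply (hl'.contDiffAt_spray hz).differentiableAt_infty.hasFDerivAt).sub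
    ((h3.clm_apply hasFDerivAt_snd).clm_apply hasFDerivAt_snd)
  have h5 := congrArg (fun f : E' × E' →L[ℝ] E => f (0, u)) (h1.unique (h4.congr_of_eventuallyEq hrel))
  simp at h5
  rw [nonlinConn_apply, nonlinConn_apply, h5, hφ.fderiv_fderiv_comm z.2 u, map_smul]
  module

/-- The D²φ term of the differentiated tangent lift cancels the one in the transformation law of N.
-/
theorem horLift_of_sprayRelated (hl : IsCoordMetric l U) (hl' : IsCoordMetric l' U')
    (hz : z ∈ U') (hφ : ContDiffAt ℝ ∞ φ z.1) (hΦ : tangentLift φ z ∈ U)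
    (hrel : ∀ᶠ z' in 𝓝 z, SprayRelatedAt l' l φ z') (u : E') :
    fderiv ℝ (tangentLift φ) z (horLift l' z u) =
      horLift l (tangentLift φ z) (fderiv ℝ φ z.1 u) := by
  rw [fderiv_tangentLift hφ, horLift_apply, horLift_apply,
    nonlinConn_of_sprayRelated hl hl' hz hφ hΦ hrel, map_neg]
  simp only [Prod.mk.injEq, true_and]
  module

theorem sprayCurvature_of_sprayRelated (hl : IsCoordMetric l U) (hl' : IsCoordMetric l' U')
    (hz : z ∈ U') (hs : IsOpen s) (hφ : ContDiffOn ℝ ∞ φ s) (hzs : z.1 ∈ s)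
    (hΦ : tangentLift φ z ∈ U) (hrel : ∀ᶠ z' in 𝓝 z, SprayRelatedAt l' l φ z') (u w : E') :
    sprayCurvature l (tangentLift φ z) (fderiv ℝ φ z.1 w) (fderiv ℝ φ z.1 u) =
      fderiv ℝ φ z.1 (sprayCurvature l' z w u) := by
  have hφz := hφ.contDiffAt (hs.mem_nhds hzs)
  -- The law for N is differentiated along the horizontal lift of w. Every correction is symmetric
  -- in u and w, so only the first term survives antisymmetrisation. The last correction accounts
  -- for Dφ(u) not being constant.
  have key : ∀ u w : E', fderiv ℝ (fun y => nonlinConn l y (fderiv ℝ φ z.1 u)) (tangentLift φ z)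
        (horLift l (tangentLift φ z) (fderiv ℝ φ z.1 w)) =
      fderiv ℝ φ z.1 (fderiv ℝ (fun y => nonlinConn l' y u) z (horLift l' z w)) +
        fderiv ℝ (fderiv ℝ φ) z.1 w (nonlinConn l' z u) +
        fderiv ℝ (fderiv ℝ φ) z.1 u (nonlinConn l' z w) -
        fderiv ℝ (fderiv ℝ (fderiv ℝ φ)) z.1 w u z.2 -
        nonlinConn l (tangentLift φ z) (fderiv ℝ (fderiv ℝ φ) z.1 w u) := by
    intro u w
    have h0 : (fun z' => nonlinConn l (tangentLift φ z') (fderiv ℝ φ z'.1 u)) =ᶠ[𝓝 z]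
        fun z' => fderiv ℝ φ z'.1 (nonlinConn l' z' u) -
          fderiv ℝ (fderiv ℝ φ) z'.1 u z'.2 := by
      filter_upwards [eventually_contDiffAt_fst hs hφ hzs, hl'.eventually_mem hz,
        (tangentLift_continuousAt hφz).eventually (hl.eventually_mem hΦ),
        hrel.eventually_nhds] with z' h1 h2 h3 h4
        using nonlinConn_of_sprayRelated hl hl' h2 h1 h3 h4 u
    have hN := (hl.contDiffAt_nonlinConn hΦ).differentiableAt_infty
    have hN' := (hl'.contDiffAt_nonlinConn hz).differentiableAt_infty
    have h1 : HasFDerivAt (fun z' => nonlinConn l (tangentLift φ z')) _ z :=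
      hN.hasFDerivAt.comp z (tangentLift_hasFDerivAt hφz).differentiableAt.hasFDerivAt
    have h2 : HasFDerivAt (fun z : E' × E' => fderiv ℝ φ z.1) _ z :=
      hφz.fderiv_infty.differentiableAt_infty.hasFDerivAt.comp z hasFDerivAt_fst
    have h3 : HasFDerivAt (fun z : E' × E' => fderiv ℝ (fderiv ℝ φ) z.1) _ z :=
      hφz.fderiv_infty.fderiv_infty.differentiableAt_infty.hasFDerivAt.comp z hasFDerivAt_fst
    have h4 := h1.clm_apply (h2.clm_apply (hasFDerivAt_const u z))
    have h5 := (h2.clm_apply (hN'.hasFDerivAt.clm_apply (hasFDerivAt_const u z))).sub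
      ((h3.clm_apply (hasFDerivAt_const u z)).clm_apply hasFDerivAt_snd)
    have h6 := congrArg (fun f : E' × E' →L[ℝ] E => f (horLift l' z w))
      (h4.unique (h5.congr_of_eventuallyEq h0))
    simp [horLift_of_sprayRelated hl hl' hz hφz hΦ hrel] at h6
    rw [fderiv_clm_const hN, fderiv_clm_const hN']
    rw [horLift_apply l' z w] at h6 ⊢
    simp only [map_neg] at h6
    rw [eq_sub_iff_add_eq, add_comm, h6]
    abel
  rw [sprayCurvature, sprayCurvature, key, key, map_sub, hφz.fderiv_infty.fderiv_fderiv_comm w u,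
    hφz.fderiv_fderiv_comm w u]
  abel

/-- Related sprays give the same curvature, contracted with the flagpole. -/
theorem fundMap_coordCurvature_of_sprayRelated (hl : IsCoordMetric l U)
    (hl' : IsCoordMetric l' U') (hz : z ∈ U') (hs : IsOpen s) (hφ : ContDiffOn ℝ ∞ φ s)
    (hzs : z.1 ∈ s) (hΦ : tangentLift φ z ∈ U) (heq : l' =ᶠ[𝓝 z] l ∘ tangentLift φ)
    (hrel : ∀ᶠ z' in 𝓝 z, SprayRelatedAt l' l φ z') (X Y Z : E') :
    fundMap l' z (coordCurvature l' z X Y Z) z.2 =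
      fundMap l (tangentLift φ z) (coordCurvature l (tangentLift φ z) (fderiv ℝ φ z.1 X)
        (fderiv ℝ φ z.1 Y) (fderiv ℝ φ z.1 Z)) (fderiv ℝ φ z.1 z.2) := by
  have h1 := hl.fundMap_coordCurvature_self hΦ (fderiv ℝ φ z.1 X) (fderiv ℝ φ z.1 Y)
    (fderiv ℝ φ z.1 Z)
  rw [sprayCurvature_of_sprayRelated hl hl' hz hs hφ hzs hΦ hrel,
    ← fundMap_comp_tangentLift hl hl' hz hs hφ hzs hΦ heq,
    ← hl'.fundMap_coordCurvature_self hz] at h1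
  exact h1.symm

end Curvature

/-- The first two derivatives of the image of a curve under a smooth map. -/
theorem deriv_and_deriv_deriv_comp {c : ℝ → E'} {t : ℝ} (hs : IsOpen s)
    (hφ : ContDiffOn ℝ ∞ φ s) (hc : ∀ᶠ r in 𝓝 t, DifferentiableAt ℝ c r)
    (hc2 : DifferentiableAt ℝ (deriv c) t) (hcs : c t ∈ s) :
    deriv (fun r => φ (c r)) t = fderiv ℝ φ (c t) (deriv c t) ∧
      deriv (deriv (fun r => φ (c r))) t =
        fderiv ℝ (fderiv ℝ φ) (c t) (deriv c t) (deriv c t) +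
          fderiv ℝ φ (c t) (deriv (deriv c) t) := by
  have h1 : ∀ r, DifferentiableAt ℝ c r → c r ∈ s →
      deriv (fun r => φ (c r)) r = fderiv ℝ φ (c r) (deriv c r) := by
    intro r hr hrs
    exact ((hφ.contDiffAt (hs.mem_nhds hrs)).differentiableAt_infty.hasFDerivAt.comp_hasDerivAt r
      hr.hasDerivAt).deriv
  have hct : DifferentiableAt ℝ c t := hc.self_of_nhds
  refine ⟨h1 t hct hcs, ?_⟩
  have h2 : deriv (fun r => φ (c r)) =ᶠ[𝓝 t] fun r => fderiv ℝ φ (c r) (deriv c r) := by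
    filter_upwards [hc, hct.continuousAt.eventually (hs.mem_nhds hcs)] with r h3 h4
      using h1 r h3 h4
  have h3 : HasDerivAt (fun r => fderiv ℝ φ (c r)) _ t :=
    (hφ.contDiffAt (hs.mem_nhds hcs)).fderiv_infty.differentiableAt_infty.hasFDerivAt.comp_hasDerivAt
      t hct.hasDerivAt
  rw [h2.deriv_eq]
  exact (h3.clm_apply hc2.hasDerivAt).deriv

end Naturality

end PseudoFinsler

end

/-! ### Passage from the manifold to preferred charts. -/

noncomputable section

open Filter Topology PseudoFinsler

namespace PseudoFinslerMetric

section Charts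

variable {E : Type*} [NormedAddCommGroup E] [NormedSpace ℝ E]
  {M : Type*} [TopologicalSpace M] [ChartedSpace E M] [IsManifold 𝓘(ℝ, E) ∞ M]

/-- The tangent vector with coordinates `z` in the preferred chart at `p`. -/
def chartVector (p : M) (z : E × E) : TangentBundle 𝓘(ℝ, E) M :=
  tangentMap 𝓘(ℝ, E) 𝓘(ℝ, E) (chartAt E p).symm ⟨z.1, z.2⟩

/-- Any `y` will do: charts of the tangent bundle depend only on the base point. Smoothness of
`chartVector` follows from this form. -/
theorem chartVector_eq (p : M) (y : E) {z : E × E} (hz : z.1 ∈ (chartAt E p).target) :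
    chartVector p z =
      (chartAt (ModelProd E E) (⟨p, y⟩ : TangentBundle 𝓘(ℝ, E) M)).symm z := by
  have : IsManifold 𝓘(ℝ, E) 1 M := IsManifold.of_le (n := ∞) (by simp)
  exact tangentMap_chart_symm (I := 𝓘(ℝ, E)) (p := (⟨p, y⟩ : TangentBundle 𝓘(ℝ, E) M))
    (q := ⟨z.1, z.2⟩) hz

theorem contMDiffOn_chartVector (p : M) :
    ContMDiffOn 𝓘(ℝ, E × E) 𝓘(ℝ, E).tangent ∞ (chartVector p : E × E → TangentBundle 𝓘(ℝ, E) M)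
      (Prod.fst ⁻¹' (chartAt E p).target) := by
  have h := contMDiffOn_chart_symm (I := 𝓘(ℝ, E).tangent) (n := ∞)
    (x := (⟨p, (0 : E)⟩ : TangentBundle 𝓘(ℝ, E) M))
  rw [modelWithCornersSelf_prod]
  refine (h.mono ?_).congr fun z hz => chartVector_eq p 0 hz
  intro z hz
  rw [TangentBundle.mem_chart_target_iff]
  exact hz

/-- At the centre of the preferred chart the coordinate change is the identity, so tangent vectors
are their own coordinates. -/
theorem chartVector_self (p : M) (y : E) :
    chartVector p (chartAt E p p, y) = (⟨p, y⟩ : TangentBundle 𝓘(ℝ, E) M) := by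
  have hp : chartAt E p p ∈ (chartAt E p).target := mem_chart_target E p
  have : IsManifold 𝓘(ℝ, E) 1 M := IsManifold.of_le (n := ∞) (by simp)
  have h := (chartAt (ModelProd E E) (⟨p, y⟩ : TangentBundle 𝓘(ℝ, E) M)).left_inv
    (mem_chart_source _ _)
  have h2 : chartAt (ModelProd E E) (⟨p, y⟩ : TangentBundle 𝓘(ℝ, E) M) ⟨p, y⟩ =
      (chartAt E p p, y) := by
    rw [TangentBundle.chartAt]
    ext
    · rfl
    · exact (tangentBundleCore 𝓘(ℝ, E) M).coordChange_self (achart E p) p (mem_chart_source E p) y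
  rw [h2] at h
  rw [chartVector_eq p y hp]
  exact h

/-- The domain of the coordinate expression of a pseudo-Finsler metric. -/
def coordDom (F : PseudoFinslerMetric E M) (p : M) : Set (E × E) :=
  {z | z.1 ∈ (chartAt E p).target ∧ chartVector p z ∈ F.dom}

theorem coord_eq (F : PseudoFinslerMetric E M) (p : M) (z : E × E) :
    F.coord p z = F.L (chartVector p z) := rfl

theorem mdifferentiableAt_chart_symm (p : M) {x : E} (hx : x ∈ (chartAt E p).target) :
    MDifferentiableAt 𝓘(ℝ, E) 𝓘(ℝ, E) (chartAt E p).symm x := by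
  have : IsManifold 𝓘(ℝ, E) 1 M := IsManifold.of_le (n := ∞) (by simp)
  exact (mdifferentiable_chart (I := 𝓘(ℝ, E)) p).symm.mdifferentiableAt hx

theorem mfderiv_chart_symm_bijective (p : M) {x : E} (hx : x ∈ (chartAt E p).target) :
    Function.Bijective (mfderiv 𝓘(ℝ, E) 𝓘(ℝ, E) (chartAt E p).symm x) := by
  have : IsManifold 𝓘(ℝ, E) 1 M := IsManifold.of_le (n := ∞) (by simp)
  exact (mdifferentiable_chart (I := 𝓘(ℝ, E)) p).symm.mfderiv_bijective hx

/-- Homogeneity and nondegeneracy transfer because the inverse chart has a linear, bijective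
derivative. -/
theorem isCoordMetric_coord (F : PseudoFinslerMetric E M) (p : M) :
    IsCoordMetric (F.coord p) (F.coordDom p) where
  isOpen := (contMDiffOn_chartVector p).continuousOn.isOpen_inter_preimage
    ((chartAt E p).open_target.preimage continuous_fst) F.isOpen_dom
  smooth z hz := by
    have hopen : IsOpen (F.coordDom p) :=
      (contMDiffOn_chartVector p).continuousOn.isOpen_inter_preimage
        ((chartAt E p).open_target.preimage continuous_fst) F.isOpen_dom
    have h : ContMDiffOn 𝓘(ℝ, E × E) 𝓘(ℝ, ℝ) ∞ (F.coord p) (F.coordDom p) :=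
      F.smooth.comp ((contMDiffOn_chartVector p).mono fun z hz => hz.1) fun z hz => hz.2
    exact h.contDiffOn.contDiffAt (hopen.mem_nhds hz)
  homogeneous z hz c hc := by
    have h := F.homogeneous _ hz.2 c hc
    let A : E →L[ℝ] E := mfderiv 𝓘(ℝ, E) 𝓘(ℝ, E) (chartAt E p).symm z.1
    rw [coord_eq, coord_eq, ← h]
    exact congrArg (fun y : E => F.L (⟨(chartAt E p).symm z.1, y⟩ : TangentBundle 𝓘(ℝ, E) M))
      (map_smul A c z.2)
  nondegenerate z hz u hu := by
    have hb := mfderiv_chart_symm_bijective p hz.1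
    let A : E →L[ℝ] E := mfderiv 𝓘(ℝ, E) 𝓘(ℝ, E) (chartAt E p).symm z.1
    apply hb.1
    refine Eq.trans ?_ (map_zero A).symm
    apply F.nondegenerate _ hz.2
    intro w
    obtain ⟨w', rfl⟩ := hb.2 w
    rw [← hu w']
    exact (PseudoFinsler.fundForm_comp
      (fun y : TangentSpace 𝓘(ℝ, E) ((chartAt E p).symm z.1) => F.L ⟨(chartAt E p).symm z.1, y⟩)
      (mfderiv 𝓘(ℝ, E) 𝓘(ℝ, E) (chartAt E p).symm z.1).toLinearMap z.2 u w').symm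

theorem fund_eq (F : PseudoFinslerMetric E M) {p : M} {y : E}
    (hv : (⟨p, y⟩ : TangentBundle 𝓘(ℝ, E) M) ∈ F.dom) (u w : E) :
    F.fund ⟨p, y⟩ u w = fundMap (F.coord p) (chartAt E p p, y) u w := by
  have hz : (chartAt E p p, y) ∈ F.coordDom p :=
    ⟨mem_chart_target E p, by rwa [chartVector_self]⟩
  rw [← (F.isCoordMetric_coord p).coordFund_eq hz, coordFund]
  simp only [coord_eq, chartVector_self]
  rfl

end Charts

/-! ### Pull-backs of metrics in charts. -/

section Pullback

variable {E : Type*} [NormedAddCommGroup E] [NormedSpace ℝ E]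
  {M : Type*} [TopologicalSpace M] [ChartedSpace E M] [IsManifold 𝓘(ℝ, E) ∞ M]
  {E' : Type*} [NormedAddCommGroup E'] [NormedSpace ℝ E']
  {S : Type*} [TopologicalSpace S] [ChartedSpace E' S] [IsManifold 𝓘(ℝ, E') ∞ S]

/-- `F'` is the pull-back of `F` by the smooth map `f`. -/
structure IsPullback (F' : PseudoFinslerMetric E' S) (F : PseudoFinslerMetric E M) (f : S → M) :
    Prop where
  smooth : ContMDiff 𝓘(ℝ, E') 𝓘(ℝ, E) ∞ f
  mem_dom : ∀ v ∈ F'.dom, tangentMap 𝓘(ℝ, E') 𝓘(ℝ, E) f v ∈ F.dom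
  L_eq : ∀ v ∈ F'.dom, F'.L v = F.L (tangentMap 𝓘(ℝ, E') 𝓘(ℝ, E) f v)

/-- The identity read in two charts is a coordinate change, so chart changes and immersions share
the same naturality lemmas. -/
theorem isPullback_id (F : PseudoFinslerMetric E M) : F.IsPullback F id where
  smooth := contMDiff_id
  mem_dom v hv := by rwa [tangentMap_id]
  L_eq v _ := by rw [tangentMap_id]; rfl

theorem isPullback_restrict (F : PseudoFinslerMetric E M) (i : S → M)
    (hi : F.IsNondegenerateSubmanifold (E' := E') i) : (F.restrict i hi).IsPullback F i where
  smooth := hi.smooth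
  mem_dom _ hv := hv
  L_eq _ _ := rfl

/-- The expression of `f : S → M` in the preferred charts at `p` and `q`. -/
def chartMap (E E' : Type*) [NormedAddCommGroup E] [NormedAddCommGroup E']
    {M : Type*} [TopologicalSpace M] [ChartedSpace E M]
    {S : Type*} [TopologicalSpace S] [ChartedSpace E' S]
    (f : S → M) (p : S) (q : M) (x : E') : E :=
  chartAt E q (f ((chartAt E' p).symm x))

/-- The domain of `chartMap`. -/
def chartMapDom (E E' : Type*) [NormedAddCommGroup E] [NormedAddCommGroup E']
    {M : Type*} [TopologicalSpace M] [ChartedSpace E M]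
    {S : Type*} [TopologicalSpace S] [ChartedSpace E' S]
    (f : S → M) (p : S) (q : M) : Set E' :=
  (chartAt E' p).target ∩ (chartAt E' p).symm ⁻¹' (f ⁻¹' (chartAt E q).source)

variable {f : S → M} {p : S} {q : M}

omit [IsManifold 𝓘(ℝ, E) ∞ M] [IsManifold 𝓘(ℝ, E') ∞ S] [NormedSpace ℝ E] [NormedSpace ℝ E'] in
theorem isOpen_chartMapDom (hf : Continuous f) : IsOpen (chartMapDom E E' f p q) :=
  (chartAt E' p).isOpen_inter_preimage_symm ((chartAt E q).open_source.preimage hf)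

theorem contDiffOn_chartMap (hf : ContMDiff 𝓘(ℝ, E') 𝓘(ℝ, E) ∞ f) :
    ContDiffOn ℝ ∞ (chartMap E E' f p q) (chartMapDom E E' f p q) := by
  rw [← contMDiffOn_iff_contDiffOn]
  exact (contMDiffOn_chart (I := 𝓘(ℝ, E)) (x := q)).comp
    (hf.comp_contMDiffOn ((contMDiffOn_chart_symm (I := 𝓘(ℝ, E')) (x := p)).mono fun x hx => hx.1))
    fun x hx => hx.2

/-- Chain rule for the two factorisations of f ∘ (chart at p)⁻¹, which agree near z.1. -/
theorem chartVector_tangentLift (hf : ContMDiff 𝓘(ℝ, E') 𝓘(ℝ, E) ∞ f) {z : E' × E'}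
    (hz : z.1 ∈ chartMapDom E E' f p q) :
    chartVector q (tangentLift (chartMap E E' f p q) z) =
      tangentMap 𝓘(ℝ, E') 𝓘(ℝ, E) f (chartVector p z) := by
  have hopen := isOpen_chartMapDom (E := E) (E' := E') (p := p) (q := q) hf.continuous
  have hφ : MDifferentiableAt 𝓘(ℝ, E') 𝓘(ℝ, E) (chartMap E E' f p q) z.1 :=
    ((contDiffOn_chartMap hf).contDiffAt (hopen.mem_nhds hz)).differentiableAt_infty.mdifferentiableAt
  have hfd : MDifferentiable 𝓘(ℝ, E') 𝓘(ℝ, E) f := hf.mdifferentiable (by simp)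
  have h1 : tangentLift (chartMap E E' f p q) z =
      ((tangentMap 𝓘(ℝ, E') 𝓘(ℝ, E) (chartMap E E' f p q) ⟨z.1, z.2⟩).1,
        (tangentMap 𝓘(ℝ, E') 𝓘(ℝ, E) (chartMap E E' f p q) ⟨z.1, z.2⟩).2) := by
    simp only [tangentMap, mfderiv_eq_fderiv]
    rfl
  have h2 : (chartAt E q).symm ∘ chartMap E E' f p q =ᶠ[𝓝 z.1] f ∘ (chartAt E' p).symm := by
    filter_upwards [hopen.mem_nhds hz] with x hx using (chartAt E q).left_inv hx.2
  have h3 := tangentMap_comp_at (⟨z.1, z.2⟩ : TangentBundle 𝓘(ℝ, E') E')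
    (mdifferentiableAt_chart_symm q ((chartAt E q).map_source hz.2)) hφ
  have h4 := tangentMap_comp_at (⟨z.1, z.2⟩ : TangentBundle 𝓘(ℝ, E') E')
    (hfd _) (mdifferentiableAt_chart_symm p hz.1)
  rw [chartVector, h1, chartVector, ← h4]
  refine h3.symm.trans ?_
  have h5 : ∀ (a b : M) (u w : E), a = b → u = w →
      (⟨a, u⟩ : TangentBundle 𝓘(ℝ, E) M) = ⟨b, w⟩ := by
    rintro a b u w rfl rfl
    rfl
  exact h5 _ _ _ _ h2.eq_of_nhds
    (congrArg (fun A : E' →L[ℝ] E => A z.2) (h2.mfderiv_eq (I := 𝓘(ℝ, E')) (I' := 𝓘(ℝ, E))))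

variable {F' : PseudoFinslerMetric E' S} {F : PseudoFinslerMetric E M}

theorem IsPullback.tangentLift_mem (h : F'.IsPullback F f) {z : E' × E'} (hz : z ∈ F'.coordDom p)
    (hzs : z.1 ∈ chartMapDom E E' f p q) :
    tangentLift (chartMap E E' f p q) z ∈ F.coordDom q := by
  refine ⟨(chartAt E q).map_source hzs.2, ?_⟩
  rw [chartVector_tangentLift h.smooth hzs]
  exact h.mem_dom _ hz.2

theorem IsPullback.coord_eq (h : F'.IsPullback F f) {z : E' × E'} (hz : z ∈ F'.coordDom p)
    (hzs : z.1 ∈ chartMapDom E E' f p q) :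
    F'.coord p =ᶠ[𝓝 z] F.coord q ∘ tangentLift (chartMap E E' f p q) := by
  have hopen := isOpen_chartMapDom (E := E) (E' := E') (p := p) (q := q) h.smooth.continuous
  filter_upwards [(F'.isCoordMetric_coord p).eventually_mem hz,
    continuous_fst.continuousAt.eventually (hopen.mem_nhds hzs)] with z' h1 h2
  rw [Function.comp_apply, F'.coord_eq, F.coord_eq, chartVector_tangentLift h.smooth h2,
    h.L_eq _ h1.2]

-- The manifold derivative is by definition taken in the preferred charts at p and i(p), so no
-- transition map intervenes.
omit [IsManifold 𝓘(ℝ, E) ∞ M] [IsManifold 𝓘(ℝ, E') ∞ S] in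
theorem fderiv_chartMap_self {i : S → M} (hf : ContMDiff 𝓘(ℝ, E') 𝓘(ℝ, E) ∞ i) (p : S) :
    fderiv ℝ (chartMap E E' i p (i p)) (chartAt E' p p) = mfderiv 𝓘(ℝ, E') 𝓘(ℝ, E) i p := by
  rw [MDifferentiableAt.mfderiv (hf.mdifferentiable (by simp) p)]
  simp only [modelWithCornersSelf_coe, Set.range_id, fderivWithin_univ]
  rfl

omit [IsManifold 𝓘(ℝ, E) ∞ M] [IsManifold 𝓘(ℝ, E') ∞ S] in
theorem tangentLift_chartMap_self {i : S → M} (hf : ContMDiff 𝓘(ℝ, E') 𝓘(ℝ, E) ∞ i) (p : S) (y : E') :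
    tangentLift (chartMap E E' i p (i p)) (chartAt E' p p, y) =
      (chartAt E (i p) (i p), (mfderiv 𝓘(ℝ, E') 𝓘(ℝ, E) i p : E' →L[ℝ] E) y) := by
  rw [tangentLift, fderiv_chartMap_self hf]
  simp only [chartMap, OpenPartialHomeomorph.left_inv _ (mem_chart_source E' p)]
  rfl

theorem fund_restrict (F : PseudoFinslerMetric E M) (i : S → M)
    (hi : F.IsNondegenerateSubmanifold (E' := E') i)
    (v : TangentBundle 𝓘(ℝ, E') S) (u w : TangentSpace 𝓘(ℝ, E') v.1) :
    (F.restrict i hi).fund v u w = F.fund (tangentMap 𝓘(ℝ, E') 𝓘(ℝ, E) i v)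
      (mfderiv 𝓘(ℝ, E') 𝓘(ℝ, E) i v.1 u) (mfderiv 𝓘(ℝ, E') 𝓘(ℝ, E) i v.1 w) :=
  PseudoFinsler.fundForm_comp
    (fun y : TangentSpace 𝓘(ℝ, E) (i v.1) => F.L ⟨i v.1, y⟩)
    (mfderiv 𝓘(ℝ, E') 𝓘(ℝ, E) i v.1).toLinearMap v.2 u w

theorem flagDenom_restrict (F : PseudoFinslerMetric E M) (i : S → M)
    (hi : F.IsNondegenerateSubmanifold (E' := E') i)
    (v : TangentBundle 𝓘(ℝ, E') S) (u : TangentSpace 𝓘(ℝ, E') v.1) :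
    (F.restrict i hi).flagDenom v u = F.flagDenom (tangentMap 𝓘(ℝ, E') 𝓘(ℝ, E) i v)
      (mfderiv 𝓘(ℝ, E') 𝓘(ℝ, E) i v.1 u) := by
  exact congrArg₂ (fun a b => F.L (tangentMap 𝓘(ℝ, E') 𝓘(ℝ, E) i v) * a - b ^ 2)
    (F.fund_restrict i hi v u u) (F.fund_restrict i hi v v.2 u)

end Pullback

end PseudoFinslerMetric

end

/-! ### Independence of the geodesic equation from the chart. -/

noncomputable section

open Filter Topology PseudoFinsler

namespace PseudoFinslerMetric

section ChartChange

variable {E : Type*} [NormedAddCommGroup E] [NormedSpace ℝ E]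
  {M : Type*} [TopologicalSpace M] [ChartedSpace E M] [IsManifold 𝓘(ℝ, E) ∞ M]

omit [IsManifold 𝓘(ℝ, E) ∞ M] [NormedSpace ℝ E] in
theorem chartMap_id_mem {p q : M} {x : E} (hx : x ∈ chartMapDom E E id p q) :
    chartMap E E id p q x ∈ chartMapDom E E id q p := by
  refine ⟨(chartAt E q).map_source hx.2, ?_⟩
  have h : (chartAt E q).symm (chartMap E E id p q x) = (chartAt E p).symm x :=
    (chartAt E q).left_inv hx.2
  rw [Set.mem_preimage, h]
  exact (chartAt E p).map_target hx.1

omit [IsManifold 𝓘(ℝ, E) ∞ M] [NormedSpace ℝ E] in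
theorem chartMap_id_chartMap_id {p q : M} {x : E} (hx : x ∈ chartMapDom E E id p q) :
    chartMap E E id q p (chartMap E E id p q x) = x := by
  have h : (chartAt E q).symm (chartMap E E id p q x) = (chartAt E p).symm x :=
    (chartAt E q).left_inv hx.2
  rw [chartMap, h]
  exact (chartAt E p).right_inv hx.1

theorem fderiv_chartMap_id_comp {p q : M} {x : E} (hx : x ∈ chartMapDom E E id p q) (y : E) :
    fderiv ℝ (chartMap E E id q p) (chartMap E E id p q x)
      (fderiv ℝ (chartMap E E id p q) x y) = y := by
  have hopen : ∀ p q : M, IsOpen (chartMapDom E E id p q) :=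
    fun p q => isOpen_chartMapDom continuous_id
  have hsm : ∀ {p q : M} {x : E}, x ∈ chartMapDom E E id p q →
      DifferentiableAt ℝ (chartMap E E id p q) x := fun {p q x} hx =>
    ((contDiffOn_chartMap (contMDiff_id (I := 𝓘(ℝ, E)) (M := M))).contDiffAt
      ((hopen p q).mem_nhds hx)).differentiableAt_infty
  have h1 : (fun x => chartMap E E id q p (chartMap E E id p q x)) =ᶠ[𝓝 x] id := by
    filter_upwards [(hopen p q).mem_nhds hx] with x' hx' using chartMap_id_chartMap_id hx'
  have h2 := (hsm (chartMap_id_mem hx)).hasFDerivAt.comp x (hsm hx).hasFDerivAt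
  have h3 := h2.unique ((hasFDerivAt_id x).congr_of_eventuallyEq h1)
  exact congrArg (fun A : E →L[ℝ] E => A y) h3

theorem fderiv_chartMap_id_injective {p q : M} {x : E} (hx : x ∈ chartMapDom E E id p q) :
    Function.Injective (fderiv ℝ (chartMap E E id p q) x) :=
  Function.LeftInverse.injective (fderiv_chartMap_id_comp hx)

theorem fderiv_chartMap_id_surjective {p q : M} {x : E} (hx : x ∈ chartMapDom E E id p q) :
    Function.Surjective (fderiv ℝ (chartMap E E id p q) x) := by
  have h := fderiv_chartMap_id_comp (chartMap_id_mem hx)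
  rw [chartMap_id_chartMap_id hx] at h
  exact Function.RightInverse.surjective h

variable [FiniteDimensional ℝ E] (F : PseudoFinslerMetric E M)

theorem sprayRelatedAt_chartMap_id {p q : M} {z : E × E} (hz : z ∈ F.coordDom p)
    (hzs : z.1 ∈ chartMapDom E E id p q) :
    SprayRelatedAt (F.coord p) (F.coord q) (chartMap E E id p q) z :=
  sprayRelatedAt_of_surjective (F.isCoordMetric_coord q) (F.isCoordMetric_coord p) hz
    (isOpen_chartMapDom continuous_id) (contDiffOn_chartMap contMDiff_id) hzs
    (F.isPullback_id.tangentLift_mem hz hzs) (F.isPullback_id.coord_eq hz hzs)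
    (fderiv_chartMap_id_surjective hzs)

/-- The geodesic equation transforms as a tangent vector. -/
theorem geodesic_eq_chartMap_id {p q : M} {c : ℝ → E} {t : ℝ}
    (hc : ∀ᶠ r in 𝓝 t, DifferentiableAt ℝ c r) (hc2 : DifferentiableAt ℝ (deriv c) t)
    (hz : (c t, deriv c t) ∈ F.coordDom p) (hzs : c t ∈ chartMapDom E E id p q) :
    deriv (deriv (fun s => chartMap E E id p q (c s))) t +
      chernSymbol (F.coord q)
        (chartMap E E id p q (c t), deriv (fun s => chartMap E E id p q (c s)) t)
        (deriv (fun s => chartMap E E id p q (c s)) t)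
        (deriv (fun s => chartMap E E id p q (c s)) t) =
      fderiv ℝ (chartMap E E id p q) (c t)
        (deriv (deriv c) t + spray (F.coord p) (c t, deriv c t)) := by
  obtain ⟨h1, h2⟩ := deriv_and_deriv_deriv_comp (isOpen_chartMapDom continuous_id)
    (contDiffOn_chartMap (p := p) (q := q) (contMDiff_id (I := 𝓘(ℝ, E)) (M := M))) hc hc2 hzs
  have h3 := F.isPullback_id.tangentLift_mem (q := q) hz hzs
  have h4 := F.sprayRelatedAt_chartMap_id (q := q) hz hzs
  have h5 := (F.isCoordMetric_coord q).chernSymbol_self_self h3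
  rw [SprayRelatedAt] at h4
  rw [h4] at h5
  rw [h2, h1, map_add]
  rw [tangentLift] at h5
  simp only at h5
  rw [h5]
  -- The D²φ term of the acceleration cancels the one in the transformed spray.
  abel

end ChartChange

/-! ### Existence of geodesics and the use of total geodesy. -/

section Geodesics

variable {E : Type*} [NormedAddCommGroup E] [NormedSpace ℝ E] [FiniteDimensional ℝ E]
  {M : Type*} [TopologicalSpace M] [ChartedSpace E M] [IsManifold 𝓘(ℝ, E) ∞ M]

/-- A smooth spray has solutions with any initial condition. -/
theorem _root_.PseudoFinsler.IsCoordMetric.exists_geodesic {l : E × E → ℝ} {U : Set (E × E)}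
    (hl : IsCoordMetric l U) {s : Set E} (hs : IsOpen s) {z : E × E} (hz : z ∈ U)
    (hzs : z.1 ∈ s) :
    ∃ (c : ℝ → E) (ε : ℝ), 0 < ε ∧ c 0 = z.1 ∧ deriv c 0 = z.2 ∧
      ContDiffOn ℝ 2 c (Set.Ioo (-ε) ε) ∧ ∀ t ∈ Set.Ioo (-ε) ε, c t ∈ s ∧
        (c t, deriv c t) ∈ U ∧ deriv (deriv c) t = -spray l (c t, deriv c t) := by
  have : CompleteSpace E := FiniteDimensional.complete ℝ E
  -- The geodesic equation as the first-order system x' = y, y' = -spray(x, y), solved by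
  -- Picard-Lindelöf.
  have hV : ContDiffAt ℝ 1 (fun z : E × E => (z.2, -spray l z)) z :=
    (contDiffAt_snd.prodMk (hl.contDiffAt_spray hz).neg).of_le (by simp)
  obtain ⟨α, hα0, ε₁, hε₁, hα⟩ :=
    hV.exists_forall_mem_closedBall_exists_eq_forall_mem_Ioo_hasDerivAt₀ 0
  simp only [zero_sub, zero_add] at hα
  have hα0c : ContinuousAt α 0 := (hα 0 ⟨by linarith, hε₁⟩).continuousAt
  have hev : ∀ᶠ t in 𝓝 (0 : ℝ), α t ∈ U ∧ (α t).1 ∈ s := by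
    have h1 : ∀ᶠ z' in 𝓝 (α 0), z' ∈ U ∧ z'.1 ∈ s := by
      rw [hα0]
      exact (hl.eventually_mem hz).and
        (continuous_fst.continuousAt.eventually (hs.mem_nhds hzs))
    exact hα0c.eventually h1
  obtain ⟨ε₂, hε₂, hball⟩ := Metric.eventually_nhds_iff.1 hev
  obtain ⟨ε, hε, h1, h2⟩ : ∃ ε > 0, ε ≤ ε₁ ∧ ε ≤ ε₂ :=
    ⟨min ε₁ ε₂, lt_min hε₁ hε₂, min_le_left _ _, min_le_right _ _⟩
  have hd : ∀ t ∈ Set.Ioo (-ε) ε, HasDerivAt α ((α t).2, -spray l (α t)) t :=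
    fun t ht => hα t ⟨by linarith [ht.1], by linarith [ht.2]⟩
  have hU : ∀ t ∈ Set.Ioo (-ε) ε, α t ∈ U ∧ (α t).1 ∈ s := by
    intro t ht
    apply hball
    rw [Real.dist_eq, sub_zero, abs_lt]
    exact ⟨by linarith [ht.1], by linarith [ht.2]⟩
  have hc1 : ∀ t ∈ Set.Ioo (-ε) ε, HasDerivAt (fun t => (α t).1) (α t).2 t :=
    fun t ht => HasFDerivAt.comp_hasDerivAt (f := α) t hasFDerivAt_fst (hd t ht)
  have hc2 : ∀ t ∈ Set.Ioo (-ε) ε, HasDerivAt (fun t => (α t).2) (-spray l (α t)) t :=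
    fun t ht => HasFDerivAt.comp_hasDerivAt (f := α) t hasFDerivAt_snd (hd t ht)
  have hder : ∀ t ∈ Set.Ioo (-ε) ε, deriv (fun t => (α t).1) t = (α t).2 :=
    fun t ht => (hc1 t ht).deriv
  have hder2 : ∀ t ∈ Set.Ioo (-ε) ε, deriv (deriv fun t => (α t).1) t = -spray l (α t) := by
    intro t ht
    rw [← (hc2 t ht).deriv]
    apply Filter.EventuallyEq.deriv_eq
    filter_upwards [isOpen_Ioo.mem_nhds ht] with r hr using hder r hr
  have h0 : (0 : ℝ) ∈ Set.Ioo (-ε) ε := ⟨by linarith, hε⟩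
  have hC2 : ContDiffOn ℝ 2 (fun t => (α t).1) (Set.Ioo (-ε) ε) := by
    -- Bootstrapping: α is continuous, so its derivative is; then the derivative of the first
    -- component, being the second component, is C¹.
    have hα1 : ContDiffOn ℝ 1 α (Set.Ioo (-ε) ε) := by
      rw [← zero_add (1 : WithTop ℕ∞), contDiffOn_succ_iff_deriv_of_isOpen isOpen_Ioo]
      refine ⟨fun t ht => (hd t ht).differentiableAt.differentiableWithinAt, by simp, ?_⟩
      rw [contDiffOn_zero]
      refine ContinuousOn.congr (f := fun t => ((α t).2, -spray l (α t))) ?_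
        fun t ht => (hd t ht).deriv
      intro t ht
      have hα := (hd t ht).continuousAt
      exact (hα.snd.prodMk (((hl.contDiffAt_spray (hU t ht).1).continuousAt.comp
        (f := α) hα).neg)).continuousWithinAt
    rw [← one_add_one_eq_two, contDiffOn_succ_iff_deriv_of_isOpen isOpen_Ioo]
    exact ⟨fun t ht => (hc1 t ht).differentiableAt.differentiableWithinAt, by simp,
      (contDiff_snd.comp_contDiffOn hα1).congr hder⟩
  refine ⟨fun t => (α t).1, ε, hε, by simp [hα0], by rw [hder 0 h0, hα0], hC2, fun t ht => ?_⟩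
  rw [hder2 t ht, hder t ht]
  exact ⟨(hU t ht).2, (hU t ht).1, rfl⟩

/-- A solution of the geodesic equation in one chart is a geodesic. -/
theorem isGeodesicOn_chart_symm (F : PseudoFinslerMetric E M) (p : M) {c : ℝ → E} {J : Set ℝ}
    (hJ : IsOpen J) (hc : ContDiffOn ℝ 2 c J) (hmem : ∀ t ∈ J, (c t, deriv c t) ∈ F.coordDom p)
    (hgeo : ∀ t ∈ J, deriv (deriv c) t = -spray (F.coord p) (c t, deriv c t)) :
    F.IsGeodesicOn (fun t => (chartAt E p).symm (c t)) J where
  contMDiffOn := by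
    have h : ContMDiffOn 𝓘(ℝ, E) 𝓘(ℝ, E) 2 (chartAt E p).symm (chartAt E p).target :=
      (contMDiffOn_chart_symm (I := 𝓘(ℝ, E)) (n := ∞) (x := p)).of_le
        (WithTop.coe_le_coe.2 (le_top : (2 : ℕ∞) ≤ ⊤))
    exact h.comp hc.contMDiffOn fun t ht => (hmem t ht).1
  velocity_mem t ht := by
    have hct : MDifferentiableAt 𝓘(ℝ, ℝ) 𝓘(ℝ, E) c t :=
      ((hc.contDiffAt (hJ.mem_nhds ht)).differentiableAt (by simp)).mdifferentiableAt
    have h1 := mfderiv_comp (I := 𝓘(ℝ, ℝ)) (I' := 𝓘(ℝ, E)) (I'' := 𝓘(ℝ, E)) t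
      (mdifferentiableAt_chart_symm p (hmem t ht).1) hct
    have h2 : (⟨(chartAt E p).symm (c t), mfderiv 𝓘(ℝ, ℝ) 𝓘(ℝ, E)
        (fun t => (chartAt E p).symm (c t)) t (1 : ℝ)⟩ : TangentBundle 𝓘(ℝ, E) M) =
        chartVector p (c t, deriv c t) := by
      have h3 : mfderiv 𝓘(ℝ, ℝ) 𝓘(ℝ, E) c t (1 : ℝ) = deriv c t := by
        rw [mfderiv_eq_fderiv]
        rfl
      have h4 : (mfderiv 𝓘(ℝ, ℝ) 𝓘(ℝ, E) (fun t => (chartAt E p).symm (c t)) t (1 : ℝ) : E) =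
          mfderiv 𝓘(ℝ, E) 𝓘(ℝ, E) (chartAt E p).symm (c t) (deriv c t) := by
        have h5 := congrArg (mfderiv 𝓘(ℝ, E) 𝓘(ℝ, E) (chartAt E p).symm (c t) : E →L[ℝ] E) h3
        exact (congrArg (fun A : ℝ →L[ℝ] E => A 1) h1).trans h5
      exact congrArg
        (fun y : E => (⟨(chartAt E p).symm (c t), y⟩ : TangentBundle 𝓘(ℝ, E) M)) h4
    rw [h2]
    exact (hmem t ht).2
  geodesic_eq t ht := by
    have hcJ : ∀ r ∈ J, ContDiffAt ℝ 2 c r := fun r hr => hc.contDiffAt (hJ.mem_nhds hr)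
    have h1 : ∀ᶠ r in 𝓝 t, DifferentiableAt ℝ c r := by
      filter_upwards [hJ.mem_nhds ht] with r hr using (hcJ r hr).differentiableAt (by simp)
    have h2 : DifferentiableAt ℝ (deriv c) t := by
      rw [← one_add_one_eq_two, contDiffOn_succ_iff_deriv_of_isOpen hJ] at hc
      exact (hc.2.2.contDiffAt (hJ.mem_nhds ht)).differentiableAt (by simp)
    -- The definition of a geodesic uses a different chart at each time, centred at the current
    -- point; the equation is moved there from the fixed chart at p.
    have h3 := F.geodesic_eq_chartMap_id (q := (chartAt E p).symm (c t)) h1 h2 (hmem t ht)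
      ⟨(hmem t ht).1, mem_chart_source E _⟩
    rw [hgeo t ht, neg_add_cancel, map_zero] at h3
    exact h3

variable {E' : Type*} [NormedAddCommGroup E'] [NormedSpace ℝ E'] [FiniteDimensional ℝ E']
  {S : Type*} [TopologicalSpace S] [ChartedSpace E' S] [IsManifold 𝓘(ℝ, E') ∞ S]
  (F : PseudoFinslerMetric E M) (i : S → M) (hi : F.IsNondegenerateSubmanifold (E' := E') i)

/-- The spray of a totally geodesic submanifold is the restriction of the ambient spray. -/
theorem IsTotallyGeodesic.sprayRelatedAt (htg : F.IsTotallyGeodesic i hi) {p : S} {q : M}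
    {z : E' × E'} (hz : z ∈ (F.restrict i hi).coordDom p)
    (hzs : z.1 ∈ chartMapDom E E' i p q) :
    SprayRelatedAt ((F.restrict i hi).coord p) (F.coord q) (chartMap E E' i p q) z := by
  have hopen := isOpen_chartMapDom (E := E) (E' := E') (p := p) (q := q) hi.smooth.continuous
  obtain ⟨c, ε, hε, hc0, hc0', hc, hgeo⟩ :=
    ((F.restrict i hi).isCoordMetric_coord p).exists_geodesic hopen hz hzs
  have h0 : (0 : ℝ) ∈ Set.Ioo (-ε) ε := ⟨by linarith, hε⟩
  have hgeoS := (F.restrict i hi).isGeodesicOn_chart_symm p isOpen_Ioo hc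
    (fun t ht => (hgeo t ht).2.1) fun t ht => (hgeo t ht).2.2
  have hgeoM := (htg _ _ isOpen_Ioo Set.ordConnected_Ioo hgeoS).geodesic_eq 0 h0
  have hφ : ContDiffOn ℝ ∞ (chartMap E E' i p q) (chartMapDom E E' i p q) :=
    contDiffOn_chartMap hi.smooth
  have hdiff : ∀ᶠ r in 𝓝 (0 : ℝ), DifferentiableAt ℝ c r := by
    filter_upwards [isOpen_Ioo.mem_nhds h0] with r hr
      using (hc.contDiffAt (isOpen_Ioo.mem_nhds hr)).differentiableAt (by simp)
  have hc' : ContDiffOn ℝ 1 (deriv c) (Set.Ioo (-ε) ε) := by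
    rw [← one_add_one_eq_two, contDiffOn_succ_iff_deriv_of_isOpen isOpen_Ioo] at hc
    exact hc.2.2
  have hdiff2 : DifferentiableAt ℝ (deriv c) 0 :=
    (hc'.contDiffAt (isOpen_Ioo.mem_nhds h0)).differentiableAt (by simp)
  obtain ⟨he1, he2⟩ := deriv_and_deriv_deriv_comp hopen hφ hdiff hdiff2 (hgeo 0 h0).1
  have hC2 : ContDiffOn ℝ 2 (fun r => chartMap E E' i p q (c r)) (Set.Ioo (-ε) ε) :=
    (hφ.of_le (WithTop.coe_le_coe.2 (le_top : (2 : ℕ∞) ≤ ⊤))).comp hc fun r hr => (hgeo r hr).1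
  have hediff : ∀ᶠ r in 𝓝 (0 : ℝ), DifferentiableAt ℝ (fun r => chartMap E E' i p q (c r)) r := by
    filter_upwards [isOpen_Ioo.mem_nhds h0] with r hr
      using (hC2.contDiffAt (isOpen_Ioo.mem_nhds hr)).differentiableAt (by simp)
  have hediff2 : DifferentiableAt ℝ (deriv fun r => chartMap E E' i p q (c r)) 0 := by
    rw [← one_add_one_eq_two, contDiffOn_succ_iff_deriv_of_isOpen isOpen_Ioo] at hC2
    exact (hC2.2.2.contDiffAt (isOpen_Ioo.mem_nhds h0)).differentiableAt (by simp)
  have hmem := (F.isPullback_restrict i hi).tangentLift_mem (q := q) hz hzs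
  have hz0 : (c 0, deriv c 0) = z := by rw [hc0, hc0']
  have hlift : (chartMap E E' i p q (c 0), deriv (fun r => chartMap E E' i p q (c r)) 0) =
      tangentLift (chartMap E E' i p q) z := by
    rw [he1, ← hz0]
    rfl
  -- The ambient equation at time 0 is given in the chart at `m`, whereas the claim is in the chart
  -- at q. The transition derivative is injective, so the equation can be brought back.
  set m : M := i ((chartAt E' p).symm (c 0)) with hm
  have hleft : ∀ r ∈ Set.Ioo (-ε) ε, (chartAt E q).symm (chartMap E E' i p q (c r)) =
      i ((chartAt E' p).symm (c r)) := fun r hr => (chartAt E q).left_inv (hgeo r hr).1.2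
  have hdom : chartMap E E' i p q (c 0) ∈ chartMapDom E E id q m := by
    refine ⟨(chartAt E q).map_source (hgeo 0 h0).1.2, ?_⟩
    rw [Set.mem_preimage, hleft 0 h0]
    exact mem_chart_source E m
  have hgeoq := F.geodesic_eq_chartMap_id (q := m) hediff hediff2 (by rwa [hlift]) hdom
  have hev : (fun r => chartMap E E id q m (chartMap E E' i p q (c r))) =ᶠ[𝓝 0]
      fun r => chartAt E m (i ((chartAt E' p).symm (c r))) := by
    filter_upwards [isOpen_Ioo.mem_nhds h0] with r hr
    rw [chartMap, hleft r hr]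
    rfl
  rw [hev.deriv.deriv_eq, hev.deriv_eq, hev.eq_of_nhds] at hgeoq
  have hzero := hgeoq.symm.trans hgeoM
  have hzero' := fderiv_chartMap_id_injective hdom (hzero.trans (map_zero _).symm)
  rw [hlift, he2, (hgeo 0 h0).2.2, hz0, hc0, hc0', map_neg] at hzero'
  rw [SprayRelatedAt, ← sub_eq_zero, ← hzero']
  abel

theorem IsTotallyGeodesic.fund_curvature (htg : F.IsTotallyGeodesic i hi) (p : S) (y : E')
    (hv : (⟨p, y⟩ : TangentBundle 𝓘(ℝ, E') S) ∈ (F.restrict i hi).dom) (X Y Z : E') :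
    (F.restrict i hi).fund ⟨p, y⟩ ((F.restrict i hi).curvature ⟨p, y⟩ X Y Z) y =
      F.fund (⟨i p, (mfderiv 𝓘(ℝ, E') 𝓘(ℝ, E) i p : E' →L[ℝ] E) y⟩ : TangentBundle 𝓘(ℝ, E) M)
        (F.curvature ⟨i p, (mfderiv 𝓘(ℝ, E') 𝓘(ℝ, E) i p : E' →L[ℝ] E) y⟩
          ((mfderiv 𝓘(ℝ, E') 𝓘(ℝ, E) i p : E' →L[ℝ] E) X)
          ((mfderiv 𝓘(ℝ, E') 𝓘(ℝ, E) i p : E' →L[ℝ] E) Y)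
          ((mfderiv 𝓘(ℝ, E') 𝓘(ℝ, E) i p : E' →L[ℝ] E) Z))
        ((mfderiv 𝓘(ℝ, E') 𝓘(ℝ, E) i p : E' →L[ℝ] E) y) := by
  have hz : (chartAt E' p p, y) ∈ (F.restrict i hi).coordDom p :=
    ⟨mem_chart_target E' p, by rwa [chartVector_self]⟩
  have hzs : chartAt E' p p ∈ chartMapDom E E' i p (i p) := by
    refine ⟨mem_chart_target E' p, ?_⟩
    simp
  have hopen := isOpen_chartMapDom (E := E) (E' := E') (p := p) (q := i p) hi.smooth.continuous
  have hpb := F.isPullback_restrict i hi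
  -- A whole neighbourhood is needed, since the curvature involves second derivatives of the spray.
  have hrel : ∀ᶠ z' in 𝓝 (chartAt E' p p, y), SprayRelatedAt ((F.restrict i hi).coord p)
      (F.coord (i p)) (chartMap E E' i p (i p)) z' := by
    filter_upwards [((F.restrict i hi).isCoordMetric_coord p).eventually_mem hz,
      continuous_fst.continuousAt.eventually (hopen.mem_nhds hzs)] with z' h1 h2
      using IsTotallyGeodesic.sprayRelatedAt F i hi htg h1 h2
  have key := fundMap_coordCurvature_of_sprayRelated (F.isCoordMetric_coord (i p))
    ((F.restrict i hi).isCoordMetric_coord p) hz hopen (contDiffOn_chartMap hi.smooth) hzs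
    (hpb.tangentLift_mem hz hzs) (hpb.coord_eq hz hzs) hrel X Y Z
  rw [tangentLift_chartMap_self hi.smooth, fderiv_chartMap_self hi.smooth] at key
  exact ((F.restrict i hi).fund_eq hv _ _).trans (key.trans (F.fund_eq (p := i p) hv _ _).symm)

end Geodesics

end PseudoFinslerMetric

end

/-! ### Equality of the flag curvatures. -/

theorem corollary3
    {E : Type*} [NormedAddCommGroup E] [NormedSpace ℝ E] [FiniteDimensional ℝ E]
    {M : Type*} [TopologicalSpace M] [ChartedSpace E M] [IsManifold 𝓘(ℝ, E) ∞ M]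
    {E' : Type*} [NormedAddCommGroup E'] [NormedSpace ℝ E'] [FiniteDimensional ℝ E']
    {S : Type*} [TopologicalSpace S] [ChartedSpace E' S] [IsManifold 𝓘(ℝ, E') ∞ S]
    (F : PseudoFinslerMetric E M) (i : S → M) (hi : F.IsNondegenerateSubmanifold (E' := E') i)
    (htg : F.IsTotallyGeodesic i hi)
    (v : TangentBundle 𝓘(ℝ, E') S) (hv : v ∈ (F.restrict i hi).dom)
    (u : TangentSpace 𝓘(ℝ, E') v.1) (hu : (F.restrict i hi).flagDenom v u ≠ 0) :
    F.flagDenom (tangentMap 𝓘(ℝ, E') 𝓘(ℝ, E) i v) (mfderiv 𝓘(ℝ, E') 𝓘(ℝ, E) i v.1 u) ≠ 0 ∧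
      (F.restrict i hi).flagCurvature v u =
        F.flagCurvature (tangentMap 𝓘(ℝ, E') 𝓘(ℝ, E) i v)
          (mfderiv 𝓘(ℝ, E') 𝓘(ℝ, E) i v.1 u) := by
  have hden := F.flagDenom_restrict i hi v u
  refine ⟨hden ▸ hu, ?_⟩
  exact congrArg₂ (· / ·) (htg.fund_curvature F i hi v.1 v.2 hv v.2 u u) hden
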